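/- Let $\overline{\Lambda}$ be a (possibly non-abelian) group with a partial order $\le$ such that $a_1\le a_2$ and $b_1\le b_2$ imply $a_1b_1\le a_2b_2$, and let $\Lambda=\{x\in\overline{\Lambda}: x\ge 1\}$ be its positive cone, a partially ordered monoid. For $x,y\in\Lambda$, call $y$ an upper neighbor of $x$ if $x<y$ and no $z\in\Lambda$ satisfies $x<z<y$. A lower set is a set $A\subseteq\Lambda$ such that $y\in A$ and $x\le y$ imply $x\in A$; let $L(\Lambda)$ be the set of finite lower sets, and $\langle x\rangle=\{y\in\Lambda: y\le x\}$. For lower sets $A,B$ put $AB=\{x\in\Lambda: x\le ab \text{ for some } a\in A,\ b\in B\}$, $A^0=\{1\}$ and $A^n=A\,A^{n-1}$. A path in $A\subseteq\Lambda$ is a (possibly empty) finite sequence $\pi=(\pi_1,\dots,\pi_m)$ of elements of $A$ such that $\pi_1$ is a minimal element of $\Lambda$ and each $\pi_{i+1}$ is an upper neighbor of $\pi_i$; its length is $\ell(\pi)=m$. A maximal path in $A$ is a path in $A$ that cannot be extended to a longer path in $A$; let $\Pi_m(A)$ be the set of these. For $A\in L(\Lambda)$ let $\ell(A)$ be the maximum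 length of a path in $A$ and $\kappa(A)=\log|\Pi_m(A)|$. Assume that $\Lambda$ is locally finite: every $\langle x\rangle$ is finite, $\Lambda$ has finitely many minimal elements, and every element of $\Lambda$ has finitely many upper neighbors. Assume that $\Lambda$ is steady: there is $C\ge 1$ with $\max_{\pi\in\Pi_m(\langle x\rangle)}\ell(\pi)\le C\min_{\pi\in\Pi_m(\langle x\rangle)}\ell(\pi)$ for all $x\in\Lambda$. Let $(\lambda_x)_{x\in\Lambda}$ be real numbers with $\lambda_-(\Lambda):=\inf_{x\in\Lambda}\lambda_x>0$ and with $\lambda_x\ge\lambda_y$ whenever $x\le y$. Let $(X_t)_{t\ge0}$ be the right-continuous Markov jump process on $L(\Lambda)$ with $X_0=\emptyset$ that moves from $A$ to $A\cup\{\alpha\}$ at rate $\lambda_\alpha$, for each minimal element $\alpha$ of $\Lambda\setminus A$; that is, $X$ solves the martingale problem for the generator $(\mathcal{L}f)(A)=\sum_{\alpha}\lambda_\alpha\,(f(A\cup\{\alpha\})-f(A))$, the sum being over the minimal elements $\alpha$ of $\Lambda\setminus A$, and $f:L(\Lambda)\to\mathbb{R}$ ranging over the finitely supported functions. For $A\in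 L(\Lambda)$ let $\tau_A=\inf\{t\ge0: A\subseteq X_t\}$. Then for every nonempty $A\in L(\Lambda)$, each $\tau_{A^n}$ is almost surely finite and square integrable, the limits $\lim_{n\to\infty}\kappa(A^n)/n$ and $\lim_{n\to\infty}\ell(A^n)/n$ exist and are finite, and so does the limit $$g(A):=\lim_{n\to\infty}\frac{\mathbb{E}[\tau_{A^n}]}{n},\qquad\text{with}\qquad g(A)\le\frac{1}{\lambda_-(\Lambda)}\left(\sqrt{\lim_{n\to\infty}\tfrac1n\kappa(A^n)}+\sqrt{\lim_{n\to\infty}\tfrac1n\ell(A^n)}\right)^2.$$ Moreover, $\tau_{A^n}/n\to g(A)$ in $L^2$ as $n\to\infty$. -/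

import Mathlib

open MeasureTheory ProbabilityTheory Filter Topology
open scoped NNReal ENNReal

noncomputable section

namespace CrystalGrowth

section Poset

variable {P : Type*} [PartialOrder P]

/-- Local finiteness of a poset: principal lower sets are finite, there are finitely many minimal
elements, and every element has finitely many upper neighbors (`a ⋖ b` says that `b` is an upper
neighbor of `a`). -/
def IsLocallyFinite (P : Type*) [PartialOrder P] : Prop :=
  (∀ a : P, (Set.Iic a).Finite) ∧ {x : P | IsMin x}.Finite ∧ ∀ a : P, {b : P | a ⋖ b}.Finite

/-- The set `L(P)` of finite lower sets of `P`. -/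
@[ext]
structure FinLowerSet (P : Type*) [PartialOrder P] where
  carrier : Set P
  finite : carrier.Finite
  lower : IsLowerSet carrier

/-- The state space `L(P)` carries the discrete σ-algebra. -/
instance : MeasurableSpace (FinLowerSet P) := ⊤

/-- The empty lower set. -/
def FinLowerSet.empty : FinLowerSet P := ⟨∅, Set.finite_empty, isLowerSet_empty⟩

/-- The growth elements of `A`: the minimal elements of the complement of `A`. -/
def growthElements (A : FinLowerSet P) : Set P := {x | Minimal (fun y => y ∉ A.carrier) x}

/-- The lower set `A ∪ {α}`, for a growth element `α` of `A`. -/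
def FinLowerSet.grow (A : FinLowerSet P) (α : growthElements A) : FinLowerSet P where
  carrier := insert α.1 A.carrier
  finite := A.finite.insert α.1
  lower := by
    intro x y hyx hx
    rcases hx with rfl | hx
    · by_cases hy : y ∈ A.carrier
      · exact Or.inr hy
      · exact Or.inl (le_antisymm hyx (α.2.2 hy hyx))
    · exact Or.inr (A.lower hyx hx)

/-- The generator `(𝓛 f)(A) = ∑_α lam α * (f (A ∪ {α}) - f A)`, the sum being over the growth
elements `α` of `A`; these are finite in number when `P` is locally finite. -/
def generator (lam : P → ℝ) (f : FinLowerSet P → ℝ) (A : FinLowerSet P) : ℝ :=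
  ∑ᶠ α : growthElements A, lam α.1 * (f (A.grow α) - f A)

/-- `X` is the crystal growth process with rates `lam`, started from the empty set: a process with
values in the discrete space `L(P)`, with right-continuous paths, that solves the martingale problem
for the generator, with the finitely supported functions as test functions. -/
structure IsGrowthProcess (lam : P → ℝ) {Ω : Type*} [mΩ : MeasurableSpace Ω] (μ : Measure Ω)
    (ℱ : Filtration ℝ≥0 mΩ) (X : ℝ≥0 → Ω → FinLowerSet P) : Prop where
  adapted : ∀ t, Measurable[ℱ t] (X t)
  initial : ∀ᵐ ω ∂μ, X 0 ω = FinLowerSet.empty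
  rightCts : ∀ᵐ ω ∂μ, ∀ t, ∀ᶠ s in 𝓝[>] t, X s ω = X t ω
  martingale : ∀ f : FinLowerSet P → ℝ, (Function.support f).Finite →
    Martingale (fun (t : ℝ≥0) ω =>
      f (X t ω) - ∫ s in (0 : ℝ)..t, generator lam f (X s.toNNReal ω)) ℱ μ

/-- The time `τ_A = inf {t : A ⊆ X_t}`, which is `∞` on the event that `A` is never covered. -/
def coverTime {Ω : Type*} (X : ℝ≥0 → Ω → FinLowerSet P) (A : Set P) (ω : Ω) : ℝ≥0∞ :=
  ⨅ (t : ℝ≥0) (_ : A ⊆ (X t ω).carrier), (t : ℝ≥0∞)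

/-- The paths in `A`: finite, possibly empty sequences in `A` that start at a minimal element of `P`
and go from each element to an upper neighbor of it. -/
def paths (A : Set P) : Set (List P) :=
  {π | π.IsChain (· ⋖ ·) ∧ (∀ x ∈ π.head?, IsMin x) ∧ ∀ x ∈ π, x ∈ A}

/-- The maximal paths in `A`, that is, those with no proper extension to a path in `A`. (A path that
is contained in another one is an initial segment of it.) -/
def maxPaths (A : Set P) : Set (List P) :=
  {π | π ∈ paths A ∧ ∀ ξ ∈ paths A, π <+: ξ → ξ = π}

/-- The length `ℓ(A)`: the maximum length of a path in `A`. -/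
def len (A : Set P) : ℕ := sSup (List.length '' paths A)

/-- The width `κ(A)`: the logarithm of the number of maximal paths in `A`. -/
def width (A : Set P) : ℝ := Real.log ((maxPaths A).ncard : ℝ)

/-- Steadiness: for some `C ≥ 1` and all `x`, the maximum of the lengths of the maximal paths in
`{y | y ≤ x}` is at most `C` times their minimum. -/
def IsSteady (P : Type*) [PartialOrder P] : Prop :=
  ∃ C : ℝ, 1 ≤ C ∧ ∀ x : P, ∀ π ∈ maxPaths (Set.Iic x), ∀ ξ ∈ maxPaths (Set.Iic x),
    (π.length : ℝ) ≤ C * (ξ.length : ℝ)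

end Poset

section Monoid

/-- The monoid `{x : G | 1 ≤ x}`, with the order and the multiplication of `G`. -/
abbrev Cone (G : Type*) [Group G] [PartialOrder G] [MulLeftMono G] : Type _ :=
  Submonoid.oneLE G

variable {M : Type*} [Monoid M] [PartialOrder M]

/-- The product `AB = {x : x ≤ a b for some a ∈ A and b ∈ B}` of lower sets. -/
def lowerMul (A B : Set M) : Set M := {x | ∃ a ∈ A, ∃ b ∈ B, x ≤ a * b}

/-- The powers `A ^ 0 = {x : x ≤ 1}` and `A ^ (n + 1) = A A ^ n`. -/
def lowerPow (A : Set M) : ℕ → Set M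
  | 0 => Set.Iic 1
  | n + 1 => lowerMul A (lowerPow A n)

end Monoid

end CrystalGrowth

end

/-!
The mean time `m S` to cover a finite target `B` from the state `S` is the solution of `𝓛 m = -1`
that vanishes once `B` is covered. Functions of the state can be compared by a maximum principle, as
every state has only finitely many states above it inside `B`. Three comparisons give the theorem.

* Upper bound. Let `W S` be the sum of `r ^ ℓ(π)` over the paths `π` in `B` that start at a growth
  element of `S` and cannot be continued. With `r = 1 / (1 - u)` and `c = inf lam`, the function
  `(c u)⁻¹ log W` is a supersolution, so that `m ∅ ≤ c⁻¹ (κ(B) / u + ℓ(B) / (1 - u))` for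
  `0 < u < 1`. The bound on the limit comes from optimizing over `u`.
* Superadditivity. After the last element `α` of `A` is covered, it remains to cover `α B`, which
  grows at smaller rates than `B`. So `m ∅` is superadditive in the target up to a bounded error,
  and Fekete's lemma gives the limit of the means. By steadiness, `κ` and `ℓ` grow linearly; they
  are almost superadditive as well, because paths can be concatenated.
* Variance. No jump of the process changes `m` by more than `c⁻¹`, so the variance of the covering
  time is at most `c⁻¹` times its mean, and the law of large numbers holds in `L²`.

The martingale problem only has finitely supported test functions, so Dynkin's formula for functions
that depend on the part of the state inside `B` is obtained through cutoffs to finite sets that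
exhaust the poset: the flow out of these sets vanishes in the limit, since the process stays in
`L(Λ)`.
-/

noncomputable section

namespace CrystalGrowth

/-! ### The maximum principle -/

section Potential

variable {P : Type*} [PartialOrder P]

/-- The elements of a finite lower set as a `Finset`, for use as an index set of sums. -/
def FinLowerSet.toFinset (B : FinLowerSet P) : Finset P := B.finite.toFinset

@[simp]
theorem FinLowerSet.mem_toFinset {B : FinLowerSet P} {x : P} : x ∈ B.toFinset ↔ x ∈ B.carrier :=
  B.finite.mem_toFinset

@[simp]
theorem FinLowerSet.coe_toFinset (B : FinLowerSet P) : (B.toFinset : Set P) = B.carrier :=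
  B.finite.coe_toFinset

variable {B : FinLowerSet P} {S : Set P} {α β : P}

open Classical in
/-- The growth elements of the state `S` that lie in the target `B`. States are arbitrary sets here,
so that they can be intersected, translated and enlarged freely. -/
def front (B : FinLowerSet P) (S : Set P) : Finset P := {α ∈ B.toFinset | Minimal (· ∉ S) α}

theorem mem_front : α ∈ front B S ↔ α ∈ B.carrier ∧ α ∉ S ∧ ∀ y < α, y ∈ S := by
  simp only [front, Finset.mem_filter, FinLowerSet.mem_toFinset, minimal_iff_forall_lt, not_not]

theorem mem_of_mem_front (h : α ∈ front B S) : α ∈ B.carrier := (mem_front.1 h).1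

theorem notMem_of_mem_front (h : α ∈ front B S) : α ∉ S := (mem_front.1 h).2.1

theorem not_subset_of_mem_front (h : α ∈ front B S) : ¬ B.carrier ⊆ S := fun hBS =>
  notMem_of_mem_front h (hBS (mem_of_mem_front h))

theorem mem_front_insert (hα : α ∈ front B S) (hne : α ≠ β) : α ∈ front B (insert β S) := by
  obtain ⟨hB, hS, hlt⟩ := mem_front.1 hα
  exact mem_front.2 ⟨hB, by simp [hne, hS], fun y hy => Or.inr (hlt y hy)⟩

theorem front_nonempty (h : ¬ B.carrier ⊆ S) : (front B S).Nonempty := by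
  obtain ⟨x, hx⟩ := Set.not_subset.1 h
  obtain ⟨m, ⟨hmB, hmS⟩, hmin⟩ := (B.finite.subset
    (Set.sep_subset B.carrier (· ∉ S))).exists_minimal ⟨x, hx⟩
  refine ⟨m, mem_front.2 ⟨hmB, hmS, fun y hy => by_contra fun hyS => ?_⟩⟩
  exact hy.not_ge (hmin ⟨B.lower hy.le hmB, hyS⟩ hy.le)

theorem isLowerSet_insert (hS : IsLowerSet S) (hα : α ∈ front B S) : IsLowerSet (insert α S) := by
  rintro x y hyx (rfl | hx)
  · exact hyx.eq_or_lt.imp_right ((mem_front.1 hα).2.2 y)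
  · exact Or.inr (hS hyx hx)

theorem front_inter (B : FinLowerSet P) (S : Set P) : front B (S ∩ B.carrier) = front B S := by
  ext α
  simp only [mem_front, Set.mem_inter_iff]
  refine and_congr_right fun hα => ?_
  simp only [hα, and_true]
  exact and_congr_right fun _ => forall₂_congr fun y hy => and_iff_left (B.lower hy.le hα)

theorem insert_inter (hα : α ∈ front B S) : insert α S ∩ B.carrier = insert α (S ∩ B.carrier) :=
  Set.insert_inter_of_mem (mem_of_mem_front hα)

theorem ncard_sdiff_insert_lt (hα : α ∈ front B S) :
    (B.carrier \ insert α S).ncard < (B.carrier \ S).ncard := by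
  refine Set.ncard_lt_ncard ?_ (B.finite.subset Set.sdiff_subset)
  exact (Set.ssubset_iff_of_subset (Set.sdiff_subset_sdiff_right (Set.subset_insert _ _))).2
    ⟨α, ⟨mem_of_mem_front hα, notMem_of_mem_front hα⟩, by simp⟩

theorem front_induction (B : FinLowerSet P) {p : Set P → Prop}
    (h : ∀ S, (∀ α ∈ front B S, p (insert α S)) → p S) (S : Set P) : p S := by
  induction hn : (B.carrier \ S).ncard using Nat.strong_induction_on generalizing S with
  | _ n ih =>
    subst hn
    exact h S fun α hα => ih _ (ncard_sdiff_insert_lt hα) _ rfl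

variable {lam : P → ℝ} {f q u v : Set P → ℝ}

/-- The generator of the growth process, acting on functions that depend only on the part of the
state inside `B`. -/
def localGenerator (lam : P → ℝ) (B : FinLowerSet P) (f : Set P → ℝ) (S : Set P) : ℝ :=
  ∑ α ∈ front B S, lam α * (f (insert α S) - f S)

theorem localGenerator_eq_sub (f : Set P → ℝ) (S : Set P) : localGenerator lam B f S =
    ∑ α ∈ front B S, lam α * f (insert α S) - (∑ α ∈ front B S, lam α) * f S := by
  simp only [localGenerator, mul_sub, Finset.sum_sub_distrib, Finset.sum_mul]

theorem localGenerator_of_subset (h : B.carrier ⊆ S) : localGenerator lam B f S = 0 :=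
  Finset.sum_eq_zero fun _ hα => absurd h (not_subset_of_mem_front hα)

/-- The functions of the state that depend only on its part inside `B`. -/
def IsLocal (B : FinLowerSet P) (f : Set P → ℝ) : Prop := ∀ S, f (S ∩ B.carrier) = f S

theorem IsLocal.localGenerator (hf : IsLocal B f) : IsLocal B (localGenerator lam B f) := by
  intro S
  rw [CrystalGrowth.localGenerator, CrystalGrowth.localGenerator, front_inter]
  exact Finset.sum_congr rfl fun α hα => by rw [← insert_inter hα, hf, hf]

theorem IsLocal.insert_of_notMem (hf : IsLocal B f) (hα : α ∉ B.carrier) :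
    f (insert α S) = f S := by
  rw [← hf, Set.insert_inter_of_notMem hα, hf]

theorem front_subset_front {A : FinLowerSet P} (hAB : A.carrier ⊆ B.carrier) :
    front A S ⊆ front B S := fun _ hα => mem_front.2 ((mem_front.1 hα).imp_left (@hAB _))

theorem localGenerator_eq_of_isLocal_of_subset {A : FinLowerSet P} (hf : IsLocal A f)
    (hAB : A.carrier ⊆ B.carrier) (S : Set P) :
    localGenerator lam B f S = localGenerator lam A f S := by
  refine (Finset.sum_subset (front_subset_front hAB) fun α hα hαA => ?_).symm
  have hα' : α ∉ A.carrier := fun h => hαA (mem_front.2 ⟨h, (mem_front.1 hα).2⟩)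
  rw [hf.insert_of_notMem hα', sub_self, mul_zero]

theorem totalRate_pos (hlam : ∀ x, 0 < lam x) (h : ¬ B.carrier ⊆ S) :
    0 < ∑ α ∈ front B S, lam α :=
  Finset.sum_pos (fun x _ => hlam x) (front_nonempty h)

theorem le_of_localGenerator_le_of_insert_le (hlam : ∀ x, 0 < lam x) (h : ¬ B.carrier ⊆ S)
    (hgen : localGenerator lam B v S ≤ localGenerator lam B u S)
    (hins : ∀ α ∈ front B S, u (insert α S) ≤ v (insert α S)) : u S ≤ v S := by
  have hsum : ∑ α ∈ front B S, lam α * u (insert α S) ≤ ∑ α ∈ front B S, lam α * v (insert α S) :=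
    Finset.sum_le_sum fun α hα => mul_le_mul_of_nonneg_left (hins α hα) (hlam α).le
  rw [localGenerator_eq_sub, localGenerator_eq_sub] at hgen
  exact le_of_mul_le_mul_left (by linarith) (totalRate_pos hlam h)

theorem le_of_localGenerator_le (hlam : ∀ x, 0 < lam x)
    (hcov : ∀ S, B.carrier ⊆ S → u S ≤ v S)
    (hgen : ∀ S, IsLowerSet S → ¬ B.carrier ⊆ S →
      localGenerator lam B v S ≤ localGenerator lam B u S)
    (hS : IsLowerSet S) : u S ≤ v S := by
  induction S using front_induction B with
  | h S ih =>
    by_cases h : B.carrier ⊆ S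
    · exact hcov S h
    · exact le_of_localGenerator_le_of_insert_le hlam h (hgen S hS h)
        fun α hα => ih α hα (isLowerSet_insert hS hα)

open Classical in
/-- The expected value of `∫ q (X s) ds` up to the time when `B` is covered, for the growth process
started from `S`, computed by conditioning on the first jump. -/
def potential (lam : P → ℝ) (B : FinLowerSet P) (q : Set P → ℝ) (S : Set P) : ℝ :=
  if B.carrier ⊆ S then 0 else
    (q S + ∑ α ∈ (front B S).attach, lam α.1 * potential lam B q (insert α.1 S)) /
      ∑ α ∈ front B S, lam α
termination_by (B.carrier \ S).ncard
decreasing_by exact ncard_sdiff_insert_lt α.2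

theorem potential_of_subset (h : B.carrier ⊆ S) : potential lam B q S = 0 := by
  rw [potential, if_pos h]

theorem localGenerator_potential (hlam : ∀ x, 0 < lam x) (h : ¬ B.carrier ⊆ S) :
    localGenerator lam B (potential lam B q) S = -q S := by
  have hR := (totalRate_pos hlam h).ne'
  rw [localGenerator_eq_sub, potential.eq_1 lam B q S, if_neg h, mul_div_cancel₀ _ hR,
    Finset.sum_attach (front B S) fun α => lam α * potential lam B q (insert α S)]
  ring

theorem potential_nonneg (hlam : ∀ x, 0 < lam x) (hq : ∀ S, 0 ≤ q S) (S : Set P) :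
    0 ≤ potential lam B q S := by
  induction S using front_induction B with
  | h S ih =>
    by_cases h : B.carrier ⊆ S
    · exact (potential_of_subset h).ge
    · refine le_of_localGenerator_le_of_insert_le (u := 0) hlam h ?_ ih
      rw [localGenerator_potential hlam h]
      simpa [localGenerator] using hq S

theorem isLocal_potential (hq : IsLocal B q) : IsLocal B (potential lam B q) := by
  intro S
  induction S using front_induction B with
  | h S ih =>
    by_cases h : B.carrier ⊆ S
    · rw [potential_of_subset h, potential_of_subset (Set.subset_inter h subset_rfl)]
    · rw [potential.eq_1 lam B q (S ∩ B.carrier), potential.eq_1 lam B q S, if_neg h,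
        if_neg fun h' => h (h'.trans Set.inter_subset_left), hq, front_inter]
      congr 2
      exact Finset.sum_congr rfl fun α _ => by rw [← insert_inter α.2, ih α.1 α.2]

/-- The expected time until `B` is covered, starting from `S`. -/
def meanCoverTime (lam : P → ℝ) (B : FinLowerSet P) : Set P → ℝ := potential lam B fun _ => 1

theorem meanCoverTime_of_subset (h : B.carrier ⊆ S) : meanCoverTime lam B S = 0 :=
  potential_of_subset h

theorem meanCoverTime_nonneg (hlam : ∀ x, 0 < lam x) (S : Set P) : 0 ≤ meanCoverTime lam B S :=
  potential_nonneg hlam (fun _ => zero_le_one) S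

theorem isLocal_meanCoverTime : IsLocal B (meanCoverTime lam B) :=
  isLocal_potential fun _ => rfl

theorem localGenerator_meanCoverTime (hlam : ∀ x, 0 < lam x) (h : ¬ B.carrier ⊆ S) :
    localGenerator lam B (meanCoverTime lam B) S = -1 :=
  localGenerator_potential hlam h

theorem neg_one_le_localGenerator_meanCoverTime (hlam : ∀ x, 0 < lam x) (S : Set P) :
    -1 ≤ localGenerator lam B (meanCoverTime lam B) S := by
  by_cases h : B.carrier ⊆ S
  · rw [localGenerator_of_subset h]
    norm_num
  · exact (localGenerator_meanCoverTime hlam h).ge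

theorem meanCoverTime_insert_le (hlam : ∀ x, 0 < lam x) (hα : α ∈ front B S) :
    meanCoverTime lam B (insert α S) ≤ meanCoverTime lam B S := by
  classical
  induction S using front_induction B generalizing α with
  | h S ih =>
  set m := meanCoverTime lam B
  refine le_of_localGenerator_le_of_insert_le (u := fun S => m (insert α S)) hlam
    (not_subset_of_mem_front hα) ?_ fun β hβ => ?_
  · rw [localGenerator_meanCoverTime hlam (not_subset_of_mem_front hα)]
    calc -1 ≤ localGenerator lam B m (insert α S) := neg_one_le_localGenerator_meanCoverTime hlam _
      _ ≤ ∑ β ∈ (front B S).erase α, lam β * (m (insert β (insert α S)) - m (insert α S)) := by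
          refine Finset.sum_le_sum_of_subset_of_nonpos' (fun β hβ => ?_) fun β hβ _ => ?_
          · exact mem_front_insert (Finset.mem_of_mem_erase hβ) (Finset.ne_of_mem_erase hβ)
          · exact mul_nonpos_of_nonneg_of_nonpos (hlam β).le (sub_nonpos.2 (ih α hα hβ))
      _ = localGenerator lam B (fun S => m (insert α S)) S := by
          rw [localGenerator, ← Finset.add_sum_erase _ _ hα]
          simp [Set.insert_comm α]
  · rcases eq_or_ne α β with rfl | hne
    · simp
    · exact ih β hβ (mem_front_insert hα hne)

theorem meanCoverTime_le_add_insert (hlam : ∀ x, 0 < lam x) (hα : α ∈ front B S) :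
    meanCoverTime lam B S ≤ 1 / lam α + meanCoverTime lam B (insert α S) := by
  classical
  induction S using front_induction B generalizing α with
  | h S ih =>
  set m := meanCoverTime lam B
  let v : Set P → ℝ := fun T => if α ∈ T then m (insert α S) else 1 / lam α + m (insert α S)
  have hv : ∀ T, α ∈ T → v T = m (insert α S) := fun T hT => if_pos hT
  have hv' : ∀ T, α ∉ T → v T = 1 / lam α + m (insert α S) := fun T hT => if_neg hT
  have hαS := notMem_of_mem_front hα
  rw [← hv' S hαS]
  refine le_of_localGenerator_le_of_insert_le hlam (not_subset_of_mem_front hα) ?_ fun β hβ => ?_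
  · rw [localGenerator_meanCoverTime hlam (not_subset_of_mem_front hα), localGenerator,
      Finset.sum_eq_single_of_mem α hα fun β _ hne => by
        rw [hv' _ (by simp [hne.symm, hαS]), hv' S hαS, sub_self, mul_zero],
      hv _ (Set.mem_insert α S), hv' S hαS, sub_add_cancel_right, mul_neg,
      mul_one_div_cancel (hlam α).ne']
  · rcases eq_or_ne α β with rfl | hne
    · exact (hv _ (Set.mem_insert α S)).ge
    · rw [hv' _ (by simp [hne, hαS])]
      refine (ih β hβ (mem_front_insert hα hne)).trans ?_
      rw [Set.insert_comm]
      gcongr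
      exact meanCoverTime_insert_le hlam (mem_front_insert hβ hne.symm)

/-- The expected square of the time until `B` is covered, starting from `S`: if the time left at
time `s` has conditional mean `m (X s)`, then its square has mean `∫ 2 m (X s) ds`. -/
def sqCoverTime (lam : P → ℝ) (B : FinLowerSet P) : Set P → ℝ :=
  potential lam B fun S => 2 * meanCoverTime lam B S

theorem sqCoverTime_nonneg (hlam : ∀ x, 0 < lam x) (S : Set P) : 0 ≤ sqCoverTime lam B S :=
  potential_nonneg hlam (fun T => mul_nonneg zero_le_two (meanCoverTime_nonneg hlam T)) S

theorem isLocal_sqCoverTime : IsLocal B (sqCoverTime lam B) :=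
  isLocal_potential fun S => congrArg (2 * ·) (isLocal_meanCoverTime S)

theorem localGenerator_sqCoverTime (hlam : ∀ x, 0 < lam x) (S : Set P) :
    localGenerator lam B (sqCoverTime lam B) S = -(2 * meanCoverTime lam B S) := by
  by_cases h : B.carrier ⊆ S
  · rw [localGenerator_of_subset h, meanCoverTime_of_subset h, mul_zero, neg_zero]
  · exact localGenerator_potential hlam h

theorem localGenerator_sq (f : Set P → ℝ) (S : Set P) :
    localGenerator lam B (fun T => f T ^ 2) S =
      2 * f S * localGenerator lam B f S +
        ∑ α ∈ front B S, lam α * (f (insert α S) - f S) ^ 2 := by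
  simp only [localGenerator, Finset.mul_sum, ← Finset.sum_add_distrib]
  exact Finset.sum_congr rfl fun α _ => by ring

/-- No single jump changes the expected remaining time by more than `c⁻¹`. -/
theorem sqCoverTime_le {c : ℝ} (hc : 0 < c) (hlam : ∀ x, c ≤ lam x) (hS : IsLowerSet S) :
    sqCoverTime lam B S ≤ meanCoverTime lam B S ^ 2 + meanCoverTime lam B S / c := by
  have hpos : ∀ x, 0 < lam x := fun x => hc.trans_le (hlam x)
  set m := meanCoverTime lam B
  refine le_of_localGenerator_le (B := B) (v := fun S => m S ^ 2 + m S / c) hpos (fun S hS => ?_)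
    (fun S _ hBS => ?_) hS
  · exact (potential_of_subset hS).trans_le (by simp [m, meanCoverTime_of_subset hS])
  have hm : localGenerator lam B m S = -1 := localGenerator_meanCoverTime hpos hBS
  have hadd : localGenerator lam B (fun S => m S ^ 2 + m S / c) S =
      localGenerator lam B (fun S => m S ^ 2) S + localGenerator lam B m S / c := by
    simp only [localGenerator, Finset.sum_div, ← Finset.sum_add_distrib]
    exact Finset.sum_congr rfl fun α _ => by ring
  have hvar : ∑ α ∈ front B S, lam α * (m (insert α S) - m S) ^ 2 ≤ 1 / c := by
    calc ∑ α ∈ front B S, lam α * (m (insert α S) - m S) ^ 2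
        ≤ ∑ α ∈ front B S, -(1 / c) * (lam α * (m (insert α S) - m S)) := by
          refine Finset.sum_le_sum fun α hα => ?_
          have hle : m (insert α S) ≤ m S := meanCoverTime_insert_le hpos hα
          have hge : m S ≤ 1 / lam α + m (insert α S) := meanCoverTime_le_add_insert hpos hα
          have hrate : 1 / lam α ≤ 1 / c := one_div_le_one_div_of_le hc (hlam α)
          calc lam α * (m (insert α S) - m S) ^ 2
              = lam α * (m S - m (insert α S)) * (m S - m (insert α S)) := by ring
            _ ≤ lam α * (m S - m (insert α S)) * (1 / c) := by
                refine mul_le_mul_of_nonneg_left (by linarith) ?_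
                exact mul_nonneg (hpos α).le (sub_nonneg.2 hle)
            _ = -(1 / c) * (lam α * (m (insert α S) - m S)) := by ring
      _ = -(1 / c) * localGenerator lam B m S := (Finset.mul_sum ..).symm
      _ = 1 / c := by rw [hm]; ring
  rw [hadd, localGenerator_sq, hm, localGenerator_sqCoverTime hpos]
  linarith [neg_div c 1]

end Potential

/-! ### The upper bound -/

section Paths

variable {P : Type*} [PartialOrder P] {A : Set P} {π ξ : List P} {x y : P}

theorem nil_mem_paths : ([] : List P) ∈ paths A := by simp [paths]

theorem append_mem_paths (h : π ++ [x] ∈ paths A) (hxy : x ⋖ y) (hy : y ∈ A) :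
    π ++ [x] ++ [y] ∈ paths A := by
  refine ⟨List.isChain_append.2 ⟨h.1, by simp, by simpa using hxy⟩, fun z hz => h.2.1 z ?_, ?_⟩
  · cases π <;> simp_all
  · intro z hz
    rcases List.mem_append.1 hz with hz | hz
    · exact h.2.2 z hz
    · exact List.mem_singleton.1 hz ▸ hy

theorem paths_of_append (h : π ++ ξ ∈ paths A) : π ∈ paths A := by
  refine ⟨(List.isChain_append.1 h.1).1, fun x hx => h.2.1 x ?_, fun x hx => h.2.2 x (by simp [hx])⟩
  cases π <;> simp_all

theorem nodup_of_mem_paths (h : π ∈ paths A) : π.Nodup := by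
  have hlt : π.IsChain (· < ·) := h.1.imp fun _ _ hcov => hcov.lt
  exact (List.isChain_iff_pairwise.1 hlt).imp fun hxy => hxy.ne

theorem finite_paths (hA : A.Finite) : (paths A).Finite := by
  refine (List.finite_length_le hA.toFinset hA.toFinset.card |>.image
    (List.map Subtype.val)).subset fun π hπ => ?_
  lift π to List hA.toFinset using fun x hx => hA.mem_toFinset.2 (hπ.2.2 x hx)
  refine ⟨π, ?_, rfl⟩
  have h := (List.Nodup.of_map _ (nodup_of_mem_paths hπ)).length_le_card
  simpa using h

theorem finite_maxPaths (hA : A.Finite) : (maxPaths A).Finite :=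
  (finite_paths hA).subset fun _ h => h.1

theorem length_le_len (hA : A.Finite) (h : π ∈ paths A) : π.length ≤ len A :=
  le_csSup ((finite_paths hA).image _).bddAbove ⟨π, h, rfl⟩

theorem exists_length_eq_len (hA : A.Finite) : ∃ π ∈ paths A, π.length = len A :=
  Nat.sSup_mem (s := List.length '' paths A) ⟨_, [], nil_mem_paths, rfl⟩
    ((finite_paths hA).image _).bddAbove

theorem exists_maxPaths (hA : A.Finite) (h : π ∈ paths A) : ∃ ξ ∈ maxPaths A, π <+: ξ := by
  obtain ⟨ξ, ⟨hξ, hπξ⟩, hmax⟩ := ((finite_paths hA).subset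
    (Set.sep_subset (paths A) (π <+: ·))).exists_maximalFor List.length _ ⟨π, h, List.prefix_rfl⟩
  refine ⟨ξ, ⟨hξ, fun ζ hζ hξζ => ?_⟩, hπξ⟩
  exact (hξζ.eq_of_length_le (hmax ⟨hζ, hπξ.trans hξζ⟩ hξζ.length_le)).symm

theorem maxPaths_nonempty (hA : A.Finite) : (maxPaths A).Nonempty :=
  let ⟨ξ, h, _⟩ := exists_maxPaths hA nil_mem_paths
  ⟨ξ, h⟩

theorem exists_maxPaths_length_eq_len (hA : A.Finite) : ∃ π ∈ maxPaths A, π.length = len A := by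
  obtain ⟨π, hπ, hlen⟩ := exists_length_eq_len hA
  obtain ⟨ξ, hξ, hp⟩ := exists_maxPaths hA hπ
  exact ⟨ξ, hξ, (length_le_len hA hξ.1).antisymm (hlen ▸ hp.length_le)⟩

theorem eq_of_prefix_or_prefix (hπ : π ∈ maxPaths A) (hξ : ξ ∈ maxPaths A)
    (h : π <+: ξ ∨ ξ <+: π) : π = ξ :=
  h.elim (fun h => (hπ.2 _ hξ.1 h).symm) (hξ.2 _ hπ.1)

open Classical in
/-- The upper neighbors of `x` in `B`. -/
def upper (B : Finset P) (x : P) : Finset P := {y ∈ B | x ⋖ y}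

theorem mem_upper {B : Finset P} : y ∈ upper B x ↔ y ∈ B ∧ x ⋖ y := by simp [upper]

theorem ncard_inter_Ioi_lt {B : Finset P} (h : y ∈ upper B x) :
    ((B : Set P) ∩ Set.Ioi y).ncard < ((B : Set P) ∩ Set.Ioi x).ncard := by
  obtain ⟨hyB, hxy⟩ := mem_upper.1 h
  refine Set.ncard_lt_ncard ?_ (B.finite_toSet.subset Set.inter_subset_left)
  refine (Set.ssubset_iff_of_subset ?_).2 ⟨y, ⟨hyB, hxy.lt⟩, by simp⟩
  exact Set.inter_subset_inter_right _ (Set.Ioi_subset_Ioi hxy.le)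

open Classical in
/-- The sum of `r ^ ℓ(π)` over the sequences `π` in `B` that start at `x`, go from each element to
an upper neighbor, and cannot be continued in `B`. -/
def pathWeight (r : ℝ) (B : Finset P) (x : P) : ℝ :=
  r * if upper B x = ∅ then 1 else ∑ y ∈ (upper B x).attach, pathWeight r B y.1
termination_by ((B : Set P) ∩ Set.Ioi x).ncard
decreasing_by exact ncard_inter_Ioi_lt y.2

variable {r : ℝ} {B : Finset P}

theorem pathWeight_of_eq_empty (h : upper B x = ∅) : pathWeight r B x = r := by
  rw [pathWeight, if_pos h, mul_one]

theorem pathWeight_of_nonempty (h : (upper B x).Nonempty) :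
    pathWeight r B x = r * ∑ y ∈ upper B x, pathWeight r B y := by
  rw [pathWeight, if_neg h.ne_empty, Finset.sum_attach (upper B x) (pathWeight r B)]

theorem upper_induction (B : Finset P) {p : P → Prop} (h : ∀ x, (∀ y ∈ upper B x, p y) → p x)
    (x : P) : p x := by
  induction hn : ((B : Set P) ∩ Set.Ioi x).ncard using Nat.strong_induction_on generalizing x with
  | _ n ih =>
    subst hn
    exact h x fun y hy => ih _ (ncard_inter_Ioi_lt hy) _ rfl

theorem sum_upper_pathWeight_le (hr : 1 ≤ r) (x : P) :
    ∑ y ∈ upper B x, pathWeight r B y ≤ r⁻¹ * pathWeight r B x := by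
  rcases (upper B x).eq_empty_or_nonempty with h | h
  · rw [h, Finset.sum_empty, pathWeight_of_eq_empty h]
    positivity
  · rw [pathWeight_of_nonempty h, inv_mul_cancel_left₀ (by positivity)]

theorem le_pathWeight (hr : 1 ≤ r) (x : P) : r ≤ pathWeight r B x := by
  induction x using upper_induction B with
  | h x ih =>
    rcases (upper B x).eq_empty_or_nonempty with h | h
    · exact (pathWeight_of_eq_empty h).ge
    · have hone : ∀ y ∈ upper B x, 1 ≤ pathWeight r B y := fun y hy => hr.trans (ih y hy)
      obtain ⟨y, hy⟩ := h
      rw [pathWeight_of_nonempty ⟨y, hy⟩]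
      refine le_mul_of_one_le_right (by positivity) ((hone y hy).trans ?_)
      exact Finset.single_le_sum (fun z hz => zero_le_one.trans (hone z hz)) hy

theorem pathWeight_pos (hr : 1 ≤ r) (x : P) : 0 < pathWeight r B x :=
  (zero_lt_one.trans_le hr).trans_le (le_pathWeight hr x)

open Classical in
/-- The number of maximal paths in `B` that extend `π`. -/
def extensions (B : Finset P) (π : List P) : ℕ :=
  ((finite_maxPaths B.finite_toSet).toFinset.filter (π <+: ·)).card

theorem sum_extensions_le (Y : Finset P) (π : List P) :
    ∑ y ∈ Y, extensions B (π ++ [y]) ≤ extensions B π := by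
  classical
  unfold extensions
  rw [← Finset.card_biUnion]
  · refine Finset.card_le_card fun ξ => ?_
    simp only [Finset.mem_biUnion, Finset.mem_filter]
    rintro ⟨y, -, hξ, hpre⟩
    exact ⟨hξ, (List.prefix_append _ _).trans hpre⟩
  · intro y _ z _ hyz
    refine Finset.disjoint_left.2 fun ξ hy hz => hyz ?_
    have hpre : π ++ [y] <+: π ++ [z] := List.prefix_of_prefix_length_le
      (Finset.mem_filter.1 hy).2 (Finset.mem_filter.1 hz).2 (by simp)
    simpa using hpre.eq_of_length (by simp)

theorem extensions_pos (h : π ∈ paths (B : Set P)) : 0 < extensions B π := by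
  classical
  obtain ⟨ξ, hξ, hp⟩ := exists_maxPaths B.finite_toSet h
  exact Finset.card_pos.2 ⟨ξ, Finset.mem_filter.2 ⟨by simpa using hξ, hp⟩⟩

theorem pathWeight_mul_le (hr : 1 ≤ r) (π : List P) (h : π ++ [x] ∈ paths (B : Set P)) :
    pathWeight r B x * r ^ π.length ≤ extensions B (π ++ [x]) * r ^ len (B : Set P) := by
  induction x using upper_induction B generalizing π with
  | h x ih =>
    rcases (upper B x).eq_empty_or_nonempty with hup | hup
    · have hlen : π.length + 1 ≤ len (B : Set P) := by simpa using length_le_len B.finite_toSet h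
      rw [pathWeight_of_eq_empty hup, ← pow_succ']
      calc r ^ (π.length + 1) ≤ r ^ len (B : Set P) := pow_le_pow_right₀ hr hlen
        _ ≤ extensions B (π ++ [x]) * r ^ len (B : Set P) :=
          le_mul_of_one_le_left (by positivity) (by exact_mod_cast extensions_pos h)
    · rw [pathWeight_of_nonempty hup]
      calc r * (∑ y ∈ upper B x, pathWeight r B y) * r ^ π.length
          = ∑ y ∈ upper B x, pathWeight r B y * r ^ (π ++ [x]).length := by
            rw [← Finset.sum_mul, List.length_append, List.length_singleton]
            ring
        _ ≤ ∑ y ∈ upper B x, extensions B (π ++ [x] ++ [y]) * r ^ len (B : Set P) :=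
            Finset.sum_le_sum fun y hy => ih y hy _
              (append_mem_paths h (mem_upper.1 hy).2 (mem_upper.1 hy).1)
        _ ≤ extensions B (π ++ [x]) * r ^ len (B : Set P) := by
            rw [← Finset.sum_mul]
            exact mul_le_mul_of_nonneg_right (by exact_mod_cast sum_extensions_le _ _)
              (by positivity)

end Paths

section UpperBound

variable {P : Type*} [PartialOrder P] {B : FinLowerSet P} {S : Set P} {x : P} {r c : ℝ}
  {lam : P → ℝ}

theorem mem_front_empty : x ∈ front B ∅ ↔ x ∈ B.carrier ∧ IsMin x := by
  simp [mem_front, isMin_iff_forall_not_lt]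

theorem singleton_mem_paths {A : Set P} (hx : IsMin x) (hxA : x ∈ A) : [x] ∈ paths A := by
  simp [paths, hx, hxA]

theorem sum_pathWeight_le (hr : 1 ≤ r) : ∑ x ∈ front B ∅, pathWeight r B.toFinset x ≤
    (maxPaths B.carrier).ncard * r ^ len B.carrier := by
  calc ∑ x ∈ front B ∅, pathWeight r B.toFinset x
      ≤ ∑ x ∈ front B ∅, extensions B.toFinset ([] ++ [x]) * r ^ len B.carrier := by
        refine Finset.sum_le_sum fun x hx => ?_
        obtain ⟨hxB, hmin⟩ := mem_front_empty.1 hx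
        simpa using pathWeight_mul_le (B := B.toFinset) hr []
          (singleton_mem_paths hmin (B.coe_toFinset.symm ▸ hxB))
    _ ≤ extensions B.toFinset [] * r ^ len B.carrier := by
        rw [← Finset.sum_mul]
        exact mul_le_mul_of_nonneg_right (by exact_mod_cast sum_extensions_le _ _) (by positivity)
    _ = (maxPaths B.carrier).ncard * r ^ len B.carrier := by
        simp [extensions, Set.ncard_eq_toFinset_card _ (finite_maxPaths B.finite)]

open Classical in
/-- The total weight of the sequences in `B` that start at a growth element of the state `S`, with
the value `1` when `B` is covered. This is the Lyapunov function of the growth process. -/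
def stateWeight (r : ℝ) (B : FinLowerSet P) (S : Set P) : ℝ :=
  if B.carrier ⊆ S then 1 else ∑ x ∈ front B S, pathWeight r B.toFinset x

theorem stateWeight_of_subset (h : B.carrier ⊆ S) : stateWeight r B S = 1 := if_pos h

theorem stateWeight_of_not_subset (h : ¬ B.carrier ⊆ S) :
    stateWeight r B S = ∑ x ∈ front B S, pathWeight r B.toFinset x := if_neg h

theorem stateWeight_pos (hr : 1 ≤ r) (S : Set P) : 0 < stateWeight r B S := by
  by_cases h : B.carrier ⊆ S
  · exact one_pos.trans_eq (stateWeight_of_subset h).symm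
  · rw [stateWeight_of_not_subset h]
    exact Finset.sum_pos (fun x _ => pathWeight_pos hr x) (front_nonempty h)

theorem front_insert_subset [DecidableEq P] (hS : IsLowerSet S) (hx : x ∈ front B S) :
    front B (insert x S) ⊆ (front B S).erase x ∪ upper B.toFinset x := by
  intro z hz
  obtain ⟨hzB, hzS, hlt⟩ := mem_front.1 hz
  simp only [Set.mem_insert_iff, not_or] at hzS hlt
  by_cases hxz : x < z
  · refine Finset.mem_union_right _ (mem_upper.2 ⟨B.mem_toFinset.2 hzB, hxz, fun w hxw hwz => ?_⟩)
    rcases hlt w hwz with rfl | hwS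
    · exact hxw.false
    · exact notMem_of_mem_front hx (hS hxw.le hwS)
  · refine Finset.mem_union_left _ (Finset.mem_erase.2 ⟨hzS.1, mem_front.2 ⟨hzB, hzS.2, ?_⟩⟩)
    exact fun y hy => (hlt y hy).resolve_left fun hyx => hxz (hyx ▸ hy)

theorem stateWeight_insert_le (hr : 1 ≤ r) (hS : IsLowerSet S) (hx : x ∈ front B S) :
    stateWeight r B (insert x S) ≤ stateWeight r B S - (1 - r⁻¹) * pathWeight r B.toFinset x := by
  classical
  have hw : ∀ z, 0 ≤ pathWeight r B.toFinset z := fun z => (pathWeight_pos hr z).le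
  rw [stateWeight_of_not_subset (not_subset_of_mem_front hx), ← Finset.add_sum_erase _ _ hx]
  suffices stateWeight r B (insert x S) ≤ ∑ z ∈ (front B S).erase x, pathWeight r B.toFinset z +
      r⁻¹ * pathWeight r B.toFinset x by linarith
  by_cases h : B.carrier ⊆ insert x S
  · rw [stateWeight_of_subset h]
    have hone : 1 ≤ r⁻¹ * pathWeight r B.toFinset x := by
      rw [← div_eq_inv_mul, one_le_div₀ (by positivity)]
      exact le_pathWeight hr x
    exact hone.trans (le_add_of_nonneg_left (Finset.sum_nonneg fun z _ => hw z))
  · rw [stateWeight_of_not_subset h]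
    calc ∑ z ∈ front B (insert x S), pathWeight r B.toFinset z
        ≤ ∑ z ∈ (front B S).erase x ∪ upper B.toFinset x, pathWeight r B.toFinset z :=
          Finset.sum_le_sum_of_subset_of_nonneg (front_insert_subset hS hx) fun z _ _ => hw z
      _ ≤ ∑ z ∈ (front B S).erase x, pathWeight r B.toFinset z +
            ∑ z ∈ upper B.toFinset x, pathWeight r B.toFinset z := by
          rw [← Finset.sum_union_inter]
          exact le_add_of_nonneg_right (Finset.sum_nonneg fun z _ => hw z)
      _ ≤ ∑ z ∈ (front B S).erase x, pathWeight r B.toFinset z +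
            r⁻¹ * pathWeight r B.toFinset x :=
          add_le_add_right (sum_upper_pathWeight_le hr x) _

theorem localGenerator_stateWeight_le (hc : 0 ≤ c) (hlam : ∀ x, c ≤ lam x) (hr : 1 ≤ r)
    (hS : IsLowerSet S) (h : ¬ B.carrier ⊆ S) :
    localGenerator lam B (stateWeight r B) S ≤ -(c * (1 - r⁻¹)) * stateWeight r B S := by
  rw [stateWeight_of_not_subset h, Finset.mul_sum]
  refine Finset.sum_le_sum fun x hx => ?_
  have hdec : 0 ≤ (1 - r⁻¹) * pathWeight r B.toFinset x :=
    mul_nonneg (sub_nonneg.2 (inv_le_one_of_one_le₀ hr)) (pathWeight_pos hr x).le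
  calc lam x * (stateWeight r B (insert x S) - stateWeight r B S)
      ≤ lam x * -((1 - r⁻¹) * pathWeight r B.toFinset x) :=
        mul_le_mul_of_nonneg_left (by linarith [stateWeight_insert_le hr hS hx])
          (hc.trans (hlam x))
    _ ≤ c * -((1 - r⁻¹) * pathWeight r B.toFinset x) :=
        mul_le_mul_of_nonpos_right (hlam x) (neg_nonpos.2 hdec)
    _ = -(c * (1 - r⁻¹)) * pathWeight r B.toFinset x := by ring

theorem localGenerator_log_le (hlam : ∀ x, 0 ≤ lam x) {f : Set P → ℝ} (hf : ∀ S, 0 < f S)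
    (S : Set P) :
    localGenerator lam B (fun T => Real.log (f T)) S ≤ localGenerator lam B f S / f S := by
  rw [localGenerator, localGenerator, Finset.sum_div]
  refine Finset.sum_le_sum fun x _ => ?_
  rw [mul_div_assoc, sub_div, div_self (hf S).ne', ← Real.log_div (hf _).ne' (hf S).ne']
  exact mul_le_mul_of_nonneg_left (Real.log_le_sub_one_of_pos (div_pos (hf _) (hf S))) (hlam x)

theorem meanCoverTime_le_log_stateWeight (hc : 0 < c) (hlam : ∀ x, c ≤ lam x) (hr : 1 < r)
    (hS : IsLowerSet S) :
    meanCoverTime lam B S ≤ Real.log (stateWeight r B S) / (c * (1 - r⁻¹)) := by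
  have hpos : ∀ x, 0 < lam x := fun x => hc.trans_le (hlam x)
  have hd : 0 < c * (1 - r⁻¹) := mul_pos hc (sub_pos.2 (inv_lt_one_of_one_lt₀ hr))
  refine le_of_localGenerator_le (B := B)
    (v := fun S => Real.log (stateWeight r B S) / (c * (1 - r⁻¹))) hpos (fun S hS => ?_)
    (fun S hS hBS => ?_) hS
  · simp [meanCoverTime_of_subset hS, stateWeight_of_subset hS]
  · have hw := stateWeight_pos (B := B) hr.le
    have hlog : localGenerator lam B (fun T => Real.log (stateWeight r B T)) S ≤
        -(c * (1 - r⁻¹)) :=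
      (localGenerator_log_le (fun x => (hpos x).le) hw S).trans
        ((div_le_iff₀ (hw S)).2 (localGenerator_stateWeight_le hc.le hlam hr.le hS hBS))
    calc localGenerator lam B (fun T => Real.log (stateWeight r B T) / (c * (1 - r⁻¹))) S
        = localGenerator lam B (fun T => Real.log (stateWeight r B T)) S / (c * (1 - r⁻¹)) := by
          simp only [localGenerator, ← sub_div, ← mul_div_assoc, Finset.sum_div]
      _ ≤ -1 := by rwa [div_le_iff₀ hd, neg_one_mul]
      _ = localGenerator lam B (meanCoverTime lam B) S :=
          (localGenerator_meanCoverTime hpos hBS).symm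

theorem ncard_maxPaths_pos {A : Set P} (hA : A.Finite) : 0 < (maxPaths A).ncard :=
  (Set.ncard_pos (finite_maxPaths hA)).2 (maxPaths_nonempty hA)

theorem log_stateWeight_empty_le (hr : 1 ≤ r) :
    Real.log (stateWeight r B ∅) ≤ width B.carrier + len B.carrier * Real.log r := by
  have hN : (1 : ℝ) ≤ (maxPaths B.carrier).ncard := by
    exact_mod_cast ncard_maxPaths_pos B.finite
  have hle : stateWeight r B ∅ ≤ (maxPaths B.carrier).ncard * r ^ len B.carrier := by
    by_cases h : B.carrier ⊆ ∅
    · rw [stateWeight_of_subset h]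
      exact one_le_mul_of_one_le_of_one_le hN (one_le_pow₀ hr)
    · rw [stateWeight_of_not_subset h]
      exact sum_pathWeight_le hr
  calc Real.log (stateWeight r B ∅)
      ≤ Real.log ((maxPaths B.carrier).ncard * r ^ len B.carrier) :=
        Real.log_le_log (stateWeight_pos hr ∅) hle
    _ = width B.carrier + len B.carrier * Real.log r := by
        rw [Real.log_mul (by positivity) (by positivity), Real.log_pow, width]

theorem meanCoverTime_empty_le (hc : 0 < c) (hlam : ∀ x, c ≤ lam x) {u : ℝ} (hu0 : 0 < u)
    (hu1 : u < 1) : meanCoverTime lam B ∅ ≤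
      1 / c * (width B.carrier / u + len B.carrier / (1 - u)) := by
  have hu : 0 < 1 - u := sub_pos.2 hu1
  have hr : 1 < (1 - u)⁻¹ := (one_lt_inv₀ hu).2 (by linarith)
  have hlog : Real.log (1 - u)⁻¹ ≤ u / (1 - u) :=
    (Real.log_le_sub_one_of_pos (by positivity)).trans_eq (by field_simp; ring)
  calc meanCoverTime lam B ∅
      ≤ Real.log (stateWeight (1 - u)⁻¹ B ∅) / (c * (1 - (1 - u)⁻¹⁻¹)) :=
        meanCoverTime_le_log_stateWeight hc hlam hr isLowerSet_empty
    _ = Real.log (stateWeight (1 - u)⁻¹ B ∅) / (c * u) := by rw [inv_inv, sub_sub_cancel]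
    _ ≤ (width B.carrier + len B.carrier * (u / (1 - u))) / (c * u) := by
        gcongr
        exact (log_stateWeight_empty_le hr.le).trans (by gcongr)
    _ = 1 / c * (width B.carrier / u + len B.carrier / (1 - u)) := by field_simp

end UpperBound

/-! ### Counting paths in products -/

section Counting

variable {P : Type*} [PartialOrder P] {A : Set P} {π : List P} {x : P}

theorem ncard_paths_length_le (hA : A.Finite) {D : ℕ} {next : List P → Finset P}
    (hnext : ∀ π x, π ++ [x] ∈ paths A → x ∈ next π) (hcard : ∀ π, (next π).card ≤ D) (k : ℕ) :
    {π ∈ paths A | π.length ≤ k}.ncard ≤ (D + 1) ^ k := by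
  classical
  induction k with
  | zero =>
    refine (Set.ncard_le_ncard (t := {[]}) fun π hπ => ?_).trans_eq (Set.ncard_singleton _)
    exact List.length_eq_zero_iff.1 (Nat.le_zero.1 hπ.2)
  | succ k ih =>
    have hfin : {π ∈ paths A | π.length ≤ k}.Finite := (finite_paths hA).subset fun _ h => h.1
    let ext (π : List P) : Finset (List P) := insert π ((next π).image (π ++ [·]))
    have hext : ∀ π ∈ hfin.toFinset, (ext π).card ≤ D + 1 := fun π _ =>
      (Finset.card_insert_le _ _).trans
        (Nat.succ_le_succ (Finset.card_image_le.trans (hcard π)))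
    have hsub : {π ∈ paths A | π.length ≤ k + 1} ⊆ (hfin.toFinset.biUnion ext : Set (List P)) := by
      rintro π ⟨hπ, hlen⟩
      simp only [Finset.coe_biUnion, Set.mem_iUnion, exists_prop, Finset.mem_coe,
        Set.Finite.mem_toFinset]
      rcases hlen.lt_or_eq with hlt | heq
      · exact ⟨π, ⟨hπ, Nat.lt_succ_iff.1 hlt⟩, Finset.mem_insert_self _ _⟩
      obtain ⟨ρ, x, rfl⟩ := (List.eq_nil_or_concat' π).resolve_left (by rintro rfl; simp at heq)
      refine ⟨ρ, ⟨paths_of_append hπ, by simpa using hlen⟩, ?_⟩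
      exact Finset.mem_insert_of_mem (Finset.mem_image_of_mem _ (hnext ρ x hπ))
    calc {π ∈ paths A | π.length ≤ k + 1}.ncard
        ≤ (hfin.toFinset.biUnion ext).card := by
          rw [← Set.ncard_coe_finset]
          exact Set.ncard_le_ncard hsub (Finset.finite_toSet _)
      _ ≤ hfin.toFinset.card * (D + 1) := Finset.card_biUnion_le_card_mul _ _ _ hext
      _ ≤ (D + 1) ^ k * (D + 1) := by
          rw [← Set.ncard_eq_toFinset_card _ hfin]
          exact Nat.mul_le_mul_right _ ih

theorem width_le (hA : A.Finite) {D : ℕ} {next : List P → Finset P}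
    (hnext : ∀ π x, π ++ [x] ∈ paths A → x ∈ next π) (hcard : ∀ π, (next π).card ≤ D) :
    width A ≤ len A * Real.log (D + 1) := by
  have hle : (maxPaths A).ncard ≤ (D + 1) ^ len A :=
    (Set.ncard_le_ncard (t := {π ∈ paths A | π.length ≤ len A})
      (fun π hπ => ⟨hπ.1, length_le_len hA hπ.1⟩)
      ((finite_paths hA).subset fun _ h => h.1)).trans (ncard_paths_length_le hA hnext hcard _)
  rw [width, ← Real.log_pow]
  exact Real.log_le_log (by exact_mod_cast ncard_maxPaths_pos hA) (by exact_mod_cast hle)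

theorem le_of_mem_path (h : π ++ [x] ∈ paths A) : ∀ y ∈ π ++ [x], y ≤ x := by
  have hlt : (π ++ [x]).Pairwise (· < ·) :=
    List.isChain_iff_pairwise.1 (h.1.imp fun _ _ h => h.lt)
  intro y hy
  rcases List.mem_append.1 hy with hy | hy
  · exact ((List.pairwise_append.1 hlt).2.2 y hy x (by simp)).le
  · exact (List.mem_singleton.1 hy).le

theorem append_mem_maxPaths_Iic (h : π ++ [x] ∈ paths A) : π ++ [x] ∈ maxPaths (Set.Iic x) := by
  refine ⟨⟨h.1, h.2.1, le_of_mem_path h⟩, ?_⟩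
  rintro ξ hξ ⟨t, rfl⟩
  cases t with
  | nil => simp
  | cons y t =>
    have hxy : x ⋖ y := (List.isChain_append.1 hξ.1).2.2 x (by simp) y (by simp)
    exact absurd (hξ.2.2 y (by simp)) hxy.lt.not_ge

theorem length_le_mul_of_steady {C : ℝ} (hfin : ∀ a : P, (Set.Iic a).Finite)
    (hC : ∀ x : P, ∀ π ∈ maxPaths (Set.Iic x), ∀ ξ ∈ maxPaths (Set.Iic x),
      (π.length : ℝ) ≤ C * (ξ.length : ℝ)) {A' : Set P} {ρ : List P} {z : P}
    (hπ : π ++ [x] ∈ paths A) (hρ : ρ ++ [z] ∈ paths A') (hxz : x ≤ z) :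
    ((π ++ [x]).length : ℝ) ≤ C * (ρ ++ [z]).length := by
  obtain ⟨ξ, hξ, hp⟩ := exists_maxPaths (A := Set.Iic z) (hfin z) (π := π ++ [x])
    ⟨hπ.1, hπ.2.1, fun y hy => (le_of_mem_path hπ y hy).trans hxz⟩
  exact (Nat.cast_le.2 hp.length_le).trans (hC z ξ hξ _ (append_mem_maxPaths_Iic hρ))

theorem exists_covBy_of_finite_Iic (hfin : ∀ a : P, (Set.Iic a).Finite) (hx : ¬ IsMin x) :
    ∃ y, y ⋖ x := by
  obtain ⟨y, hy⟩ := not_isMin_iff.1 hx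
  obtain ⟨m, hm⟩ := ((hfin x).subset Set.Iio_subset_Iic_self).exists_maximal ⟨y, hy⟩
  exact ⟨m, hm.1, fun z hmz hzx => hmz.not_ge (hm.2 hzx hmz.le)⟩

end Counting

section Translation

variable {M : Type*} [Monoid M] [PartialOrder M] [CanonicallyOrderedMul M]

theorem isMin_iff_eq_one {x : M} : IsMin x ↔ x = 1 :=
  ⟨fun h => eq_one_of_le_one (h one_le), fun h _ _ => h ▸ one_le⟩

theorem one_mem_of_isLowerSet {A : Set M} (hA : IsLowerSet A) (hne : A.Nonempty) : 1 ∈ A :=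
  let ⟨_, ha⟩ := hne
  hA one_le ha

theorem mul_le_mul_of_le_of_le {a b c d : M} (hab : a ≤ b) (hcd : c ≤ d) : a * c ≤ b * d := by
  obtain ⟨z, rfl⟩ := exists_mul_of_le hab
  rw [mul_assoc]
  exact mul_le_mul_right (hcd.trans le_mul_self) a

variable [MulLeftReflectLE M]

/-- Left multiplication by `a`, which identifies `M` with `{x | a ≤ x}` as a poset. -/
def mulLeftEmbedding (a : M) : M ↪o M :=
  OrderEmbedding.ofMapLEIff (a * ·) fun _ _ => mul_le_mul_iff_left a

theorem mul_covBy_mul_iff {a x y : M} : a * x ⋖ a * y ↔ x ⋖ y := by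
  refine Set.OrdConnected.apply_covBy_apply_iff (mulLeftEmbedding a) ?_
  convert Set.ordConnected_Ici (a := a)
  ext x
  simp [mulLeftEmbedding, le_iff_exists_mul, eq_comm]

theorem covBy_mul_iff {a s : M} : a ⋖ a * s ↔ 1 ⋖ s := by
  simpa using mul_covBy_mul_iff (a := a) (x := 1) (y := s)

theorem exists_atoms_prod_eq (hfin : ∀ a : M, (Set.Iic a).Finite) (a : M) :
    ∃ l : List M, (∀ s ∈ l, 1 ⋖ s) ∧ l.prod = a := by
  induction hn : (Set.Iic a).ncard using Nat.strong_induction_on generalizing a with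
  | _ n ih =>
    subst hn
    by_cases ha : IsMin a
    · exact ⟨[], by simp, (isMin_iff_eq_one.1 ha).symm⟩
    obtain ⟨b, hb⟩ := exists_covBy_of_finite_Iic hfin ha
    obtain ⟨s, rfl⟩ := exists_mul_of_le hb.le
    have hlt : (Set.Iic b).ncard < (Set.Iic (b * s)).ncard :=
      Set.ncard_lt_ncard (Set.Iic_ssubset_Iic.2 hb.lt) (hfin _)
    obtain ⟨l, hl, rfl⟩ := ih _ hlt b rfl
    refine ⟨l ++ [s], fun t ht => ?_, by simp⟩
    rcases List.mem_append.1 ht with ht | ht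
    · exact hl t ht
    · exact List.mem_singleton.1 ht ▸ covBy_mul_iff.1 hb

theorem exists_path_to_prod {l : List M} (hl : ∀ s ∈ l, 1 ⋖ s) :
    ∃ π : List M, π.length = l.length ∧ π ++ [l.prod] ∈ paths (Set.univ : Set M) := by
  induction l using List.reverseRecOn with
  | nil => exact ⟨[], rfl, singleton_mem_paths (isMin_iff_eq_one.2 rfl) trivial⟩
  | append_singleton l s ih =>
    obtain ⟨π, hlen, hπ⟩ := ih fun t ht => hl t (by simp [ht])
    refine ⟨π ++ [l.prod], by simp [hlen], ?_⟩
    rw [List.prod_append, List.prod_singleton]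
    exact append_mem_paths hπ (covBy_mul_iff.2 (hl s (by simp))) trivial

theorem exists_short_atoms_prod_eq (hfin : ∀ a : M, (Set.Iic a).Finite) {A : Set M}
    (hA : A.Finite) (hlow : IsLowerSet A) {a : M} (ha : a ∈ A) :
    ∃ l : List M, (∀ s ∈ l, 1 ⋖ s) ∧ l.prod = a ∧ l.length ≤ len A := by
  obtain ⟨l, hl, rfl⟩ := exists_atoms_prod_eq hfin a
  obtain ⟨π, hlen, hπ⟩ := exists_path_to_prod hl
  have hπA : π ++ [l.prod] ∈ paths A :=
    ⟨hπ.1, hπ.2.1, fun y hy => hlow (le_of_mem_path hπ y hy) ha⟩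
  refine ⟨l, hl, rfl, hlen ▸ (Nat.le_succ _).trans ?_⟩
  simpa using length_le_len hA hπA

theorem width_le_len_mul_log (hup : {s : M | 1 ⋖ s}.Finite) {A : Set M} (hA : A.Finite) :
    width A ≤ len A * Real.log ({s : M | 1 ⋖ s}.ncard + 2) := by
  classical
  let next (π : List M) : Finset M := insert 1 (hup.toFinset.image (π.getLastD 1 * ·))
  have hcard (π : List M) : (next π).card ≤ {s : M | 1 ⋖ s}.ncard + 1 := by
    rw [Set.ncard_eq_toFinset_card _ hup]
    exact (Finset.card_insert_le _ _).trans (Nat.succ_le_succ Finset.card_image_le)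
  refine (width_le hA (next := next) (fun π x h => ?_) hcard).trans_eq ?_
  · rcases List.eq_nil_or_concat' π with rfl | ⟨ρ, y, rfl⟩
    · exact Finset.mem_insert.2 (Or.inl (isMin_iff_eq_one.1 (h.2.1 x rfl)))
    · have hyx : y ⋖ x := (List.isChain_append.1 h.1).2.2 y (by simp) x (by simp)
      obtain ⟨s, rfl⟩ := exists_mul_of_le hyx.le
      refine Finset.mem_insert_of_mem (Finset.mem_image.2 ⟨s, ?_, by simp⟩)
      exact hup.mem_toFinset.2 (covBy_mul_iff.1 hyx)
  · push_cast
    ring_nf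

end Translation

section LowerMul

variable {M : Type*} [Monoid M] [PartialOrder M] {A B : Set M}

theorem isLowerSet_lowerMul (A B : Set M) : IsLowerSet (lowerMul A B) := by
  rintro x y hyx ⟨a, ha, b, hb, h⟩
  exact ⟨a, ha, b, hb, hyx.trans h⟩

theorem finite_lowerMul (hfin : ∀ a : M, (Set.Iic a).Finite) (hA : A.Finite) (hB : B.Finite) :
    (lowerMul A B).Finite := by
  refine (hA.biUnion fun a _ => hB.biUnion fun b _ => hfin (a * b)).subset ?_
  rintro x ⟨a, ha, b, hb, h⟩
  exact Set.mem_biUnion ha (Set.mem_biUnion hb h)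

theorem mul_mem_lowerMul {a b : M} (ha : a ∈ A) (hb : b ∈ B) : a * b ∈ lowerMul A B :=
  ⟨a, ha, b, hb, le_rfl⟩

theorem subset_lowerMul (hB : 1 ∈ B) : A ⊆ lowerMul A B :=
  fun a ha => ⟨a, ha, 1, hB, (mul_one a).ge⟩

theorem isLowerSet_lowerPow (A : Set M) (n : ℕ) : IsLowerSet (lowerPow A n) := by
  cases n with
  | zero => exact isLowerSet_Iic 1
  | succ n => exact isLowerSet_lowerMul _ _

theorem finite_lowerPow (hfin : ∀ a : M, (Set.Iic a).Finite) (hA : A.Finite) (n : ℕ) :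
    (lowerPow A n).Finite := by
  induction n with
  | zero => exact hfin 1
  | succ n ih => exact finite_lowerMul hfin hA ih

theorem one_mem_lowerPow (hA : 1 ∈ A) (n : ℕ) : 1 ∈ lowerPow A n := by
  induction n with
  | zero => exact le_rfl
  | succ n ih => exact ⟨1, hA, 1, ih, (mul_one 1).ge⟩

variable [CanonicallyOrderedMul M]

theorem lowerMul_assoc (A B C : Set M) :
    lowerMul (lowerMul A B) C = lowerMul A (lowerMul B C) := by
  ext x
  constructor
  · rintro ⟨y, ⟨a, ha, b, hb, hy⟩, c, hc, hx⟩
    refine ⟨a, ha, b * c, mul_mem_lowerMul hb hc, hx.trans ?_⟩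
    rw [← mul_assoc]
    exact mul_le_mul_of_le_of_le hy le_rfl
  · rintro ⟨a, ha, y, ⟨b, hb, c, hc, hy⟩, hx⟩
    refine ⟨a * b, mul_mem_lowerMul ha hb, c, hc, hx.trans ?_⟩
    rw [mul_assoc]
    exact mul_le_mul_of_le_of_le le_rfl hy

theorem lowerMul_Iic_one (hB : IsLowerSet B) : lowerMul (Set.Iic 1) B = B := by
  ext x
  refine ⟨?_, fun hx => ⟨1, le_rfl, x, hx, (one_mul x).ge⟩⟩
  rintro ⟨a, ha, b, hb, hx⟩
  refine hB (hx.trans ?_) hb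
  simpa using mul_le_mul_of_le_of_le (Set.mem_Iic.1 ha) (le_refl b)

theorem lowerPow_add (A : Set M) (m n : ℕ) :
    lowerPow A (m + n) = lowerMul (lowerPow A m) (lowerPow A n) := by
  induction m with
  | zero => rw [zero_add, lowerPow, lowerMul_Iic_one (isLowerSet_lowerPow A n)]
  | succ m ih => rw [Nat.succ_add, lowerPow, lowerPow, ih, lowerMul_assoc]

theorem exists_eq_one_cons {ξ : List M} (h : ξ ∈ paths A) (hne : ξ ≠ []) : ∃ t, ξ = 1 :: t := by
  cases ξ with
  | nil => exact absurd rfl hne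
  | cons y t => exact ⟨t, by rw [isMin_iff_eq_one.1 (h.2.1 y rfl)]⟩

theorem ne_nil_of_mem_maxPaths (hA : 1 ∈ A) {ξ : List M} (hξ : ξ ∈ maxPaths A) : ξ ≠ [] := by
  rintro rfl
  simpa using hξ.2 _ (singleton_mem_paths (isMin_iff_eq_one.2 rfl) hA) List.nil_prefix

variable [MulLeftReflectLE M]

theorem exists_atoms_of_mem_lowerPow (hfin : ∀ a : M, (Set.Iic a).Finite) (hA : A.Finite)
    (hlow : IsLowerSet A) (n : ℕ) {x : M} (hx : x ∈ lowerPow A n) :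
    ∃ l : List M, (∀ s ∈ l, 1 ⋖ s) ∧ x ≤ l.prod ∧ l.length ≤ n * len A := by
  induction n generalizing x with
  | zero => exact ⟨[], by simp, hx, by simp⟩
  | succ n ih =>
    obtain ⟨a, ha, b, hb, hx⟩ := hx
    obtain ⟨l, hl, rfl, hlen⟩ := exists_short_atoms_prod_eq hfin hA hlow ha
    obtain ⟨l', hl', hb', hlen'⟩ := ih hb
    refine ⟨l ++ l', fun s hs => (List.mem_append.1 hs).elim (hl s) (hl' s), ?_, ?_⟩
    · rw [List.prod_append]
      exact hx.trans (mul_le_mul_of_le_of_le le_rfl hb')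
    · rw [List.length_append]
      linarith

theorem exists_len_lowerPow_le (hfin : ∀ a : M, (Set.Iic a).Finite) (hsteady : IsSteady M)
    (hA : A.Finite) (hlow : IsLowerSet A) :
    ∃ K : ℝ, 0 ≤ K ∧ ∀ n : ℕ, (len (lowerPow A n) : ℝ) ≤ K * (n + 1) := by
  obtain ⟨C, hC1, hC⟩ := hsteady
  refine ⟨C * (len A + 1), by positivity, fun n => ?_⟩
  obtain ⟨π, hπ, hπl⟩ := exists_length_eq_len (finite_lowerPow hfin hA n)
  rw [← hπl]
  rcases List.eq_nil_or_concat' π with rfl | ⟨ρ, x, rfl⟩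
  · rw [List.length_nil, Nat.cast_zero]
    positivity
  obtain ⟨l, hl, hxl, hlen⟩ :=
    exists_atoms_of_mem_lowerPow hfin hA hlow n (hπ.2.2 x (by simp))
  obtain ⟨ξ, hξl, hξ⟩ := exists_path_to_prod hl
  have hlen' : (l.length : ℝ) ≤ n * len A := by exact_mod_cast hlen
  calc ((ρ ++ [x]).length : ℝ) ≤ C * (ξ ++ [l.prod]).length :=
        length_le_mul_of_steady hfin hC hπ hξ hxl
    _ = C * (l.length + 1) := by simp [hξl]
    _ ≤ C * ((len A + 1) * (n + 1)) := by
        gcongr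
        nlinarith [n.cast_nonneg (α := ℝ), (len A).cast_nonneg (α := ℝ)]
    _ = C * (len A + 1) * (n + 1) := by ring

theorem append_map_mem_paths {C : Set M} (hAC : A ⊆ C) {π ξ : List M} {a : M}
    (hBC : ∀ b ∈ B, a * b ∈ C) (hπ : π ++ [a] ∈ paths A) (hξ : 1 :: ξ ∈ paths B) :
    π ++ [a] ++ ξ.map (a * ·) ∈ paths C := by
  refine ⟨List.isChain_append.2 ⟨hπ.1, ?_, ?_⟩, ?_, ?_⟩
  · rw [List.isChain_map]
    exact (List.isChain_cons.1 hξ.1).2.imp fun x y h => mul_covBy_mul_iff.2 h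
  · cases ξ with
    | nil => simp
    | cons y t =>
      have hy : 1 ⋖ y := (List.isChain_cons.1 hξ.1).1 y (by simp)
      simpa using covBy_mul_iff.2 hy
  · intro x hx
    refine hπ.2.1 x ?_
    cases π <;> simp_all
  · intro x hx
    rcases List.mem_append.1 hx with hx | hx
    · exact hAC (hπ.2.2 x hx)
    · obtain ⟨y, hy, rfl⟩ := List.mem_map.1 hx
      exact hBC y (hξ.2.2 y (by simp [hy]))

theorem append_map_tail_mem_paths (hA1 : 1 ∈ A) (hB1 : 1 ∈ B) {π ξ : List M}
    (hπ : π ∈ maxPaths A) (hξ : ξ ∈ maxPaths B) :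
    π ++ ξ.tail.map (π.getLastD 1 * ·) ∈ paths (lowerMul A B) := by
  obtain ⟨t, rfl⟩ := exists_eq_one_cons hξ.1 (ne_nil_of_mem_maxPaths hB1 hξ)
  obtain ⟨ρ, a, rfl⟩ := (List.eq_nil_or_concat' π).resolve_left (ne_nil_of_mem_maxPaths hA1 hπ)
  simpa using append_map_mem_paths (subset_lowerMul hB1)
    (fun b hb => mul_mem_lowerMul (hπ.1.2.2 a (by simp)) hb) hπ.1 hξ.1

theorem len_add_len_le (hA : A.Finite) (hB : B.Finite) (hAB : (lowerMul A B).Finite)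
    (hA1 : 1 ∈ A) (hB1 : 1 ∈ B) : len A + len B ≤ len (lowerMul A B) + 1 := by
  obtain ⟨π, hπ, hπl⟩ := exists_maxPaths_length_eq_len hA
  obtain ⟨ξ, hξ, hξl⟩ := exists_maxPaths_length_eq_len hB
  have hle := length_le_len hAB (append_map_tail_mem_paths hA1 hB1 hπ hξ)
  simp only [List.length_append, List.length_map, List.length_tail] at hle
  omega

theorem eq_of_append_map_tail_prefix (hB1 : 1 ∈ B) {π π' ξ ξ' ζ : List M}
    (hπ : π ∈ maxPaths A) (hπ' : π' ∈ maxPaths A) (hξ : ξ ∈ maxPaths B) (hξ' : ξ' ∈ maxPaths B)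
    (h : π ++ ξ.tail.map (π.getLastD 1 * ·) <+: ζ)
    (h' : π' ++ ξ'.tail.map (π'.getLastD 1 * ·) <+: ζ) : π = π' ∧ ξ = ξ' := by
  obtain rfl : π = π' := eq_of_prefix_or_prefix hπ hπ' (List.prefix_or_prefix_of_prefix
    ((List.prefix_append _ _).trans h) ((List.prefix_append _ _).trans h'))
  refine ⟨rfl, eq_of_prefix_or_prefix hξ hξ' ?_⟩
  have hinj : Function.Injective (π.getLastD 1 * ·) := (mulLeftEmbedding _).injective
  have hcomp := List.prefix_or_prefix_of_prefix h h'
  rw [List.prefix_append_right_inj, List.prefix_append_right_inj,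
    List.prefix_map_iff_of_injective hinj, List.prefix_map_iff_of_injective hinj] at hcomp
  obtain ⟨t, rfl⟩ := exists_eq_one_cons hξ.1 (ne_nil_of_mem_maxPaths hB1 hξ)
  obtain ⟨t', rfl⟩ := exists_eq_one_cons hξ'.1 (ne_nil_of_mem_maxPaths hB1 hξ')
  simpa using hcomp

theorem width_add_width_le (hA : A.Finite) (hB : B.Finite) (hAB : (lowerMul A B).Finite)
    (hA1 : 1 ∈ A) (hB1 : 1 ∈ B) : width A + width B ≤ width (lowerMul A B) := by
  have hext : ∀ p ∈ maxPaths A ×ˢ maxPaths B, ∃ ζ ∈ maxPaths (lowerMul A B),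
      p.1 ++ p.2.tail.map (p.1.getLastD 1 * ·) <+: ζ := fun p hp =>
    exists_maxPaths hAB (append_map_tail_mem_paths hA1 hB1 hp.1 hp.2)
  choose! f hf hprefix using hext
  have hinj : Set.InjOn f (maxPaths A ×ˢ maxPaths B) := fun p hp p' hp' he =>
    Prod.ext_iff.2 (eq_of_append_map_tail_prefix hB1 hp.1 hp'.1 hp.2 hp'.2 (hprefix p hp)
      (he ▸ hprefix p' hp'))
  have hle : (maxPaths A).ncard * (maxPaths B).ncard ≤ (maxPaths (lowerMul A B)).ncard := by
    rw [← Set.ncard_prod]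
    exact Set.ncard_le_ncard_of_injOn f hf hinj (finite_maxPaths hAB)
  have hApos := ncard_maxPaths_pos hA
  have hBpos := ncard_maxPaths_pos hB
  rw [width, width, width, ← Real.log_mul (by positivity) (by positivity)]
  exact Real.log_le_log (by positivity) (by exact_mod_cast hle)

end LowerMul

/-! ### Superadditivity -/

section Superadditivity

variable {M : Type*} [Monoid M] [PartialOrder M] [CanonicallyOrderedMul M] {lam : M → ℝ}
  {A B C : FinLowerSet M} {S : Set M} {a α : M}

theorem meanCoverTime_empty (hlam : ∀ x, 0 < lam x) (hB : 1 ∈ B.carrier) :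
    meanCoverTime lam B ∅ = 1 / lam 1 + meanCoverTime lam B {1} := by
  have hfront : front B ∅ = {1} := by
    ext x
    rw [mem_front_empty, isMin_iff_eq_one, Finset.mem_singleton]
    exact and_iff_right_of_imp fun hx => hx ▸ hB
  have hgen := localGenerator_meanCoverTime (S := ∅) hlam fun h => h hB
  rw [localGenerator, hfront, Finset.sum_singleton, insert_empty_eq] at hgen
  have hpos := hlam 1
  field_simp
  linarith

variable [MulLeftReflectLE M]

theorem preimage_insert_inter_of_notMem_image (hα : α ∈ front C S)
    (himg : α ∉ (front B ((a * ·) ⁻¹' S)).map (mulLeftEmbedding a).toEmbedding) :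
    (a * ·) ⁻¹' insert α S ∩ B.carrier = (a * ·) ⁻¹' S ∩ B.carrier := by
  refine subset_antisymm ?_ (Set.inter_subset_inter_left _ fun y hy => Or.inr hy)
  rintro y ⟨rfl | hyS, hyB⟩
  · refine absurd (Finset.mem_map_of_mem (mulLeftEmbedding a).toEmbedding ?_) himg
    obtain ⟨-, hyS, hlt⟩ := mem_front.1 hα
    exact mem_front.2 ⟨hyB, hyS, fun z hz => hlt _ ((mulLeftEmbedding a).lt_iff_lt.2 hz)⟩
  · exact ⟨hyS, hyB⟩

/-- The translated copy `a B` of the target grows at smaller rates than `B`, as `lam` is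
antitone. -/
theorem neg_one_le_localGenerator_translate (hlam : ∀ x, 0 < lam x) (hanti : Antitone lam)
    (S : Set M) :
    -1 ≤ localGenerator lam C (fun T => meanCoverTime lam B ((a * ·) ⁻¹' T)) S := by
  classical
  set T := (a * ·) ⁻¹' S with hT
  let m : Set M → ℝ := fun S => meanCoverTime lam B ((a * ·) ⁻¹' S)
  have hpre : ∀ β, m (insert (a * β) S) = meanCoverTime lam B (insert β T) := fun β => by
    refine congrArg (meanCoverTime lam B) ?_
    ext y
    simp [hT]
  have hdec : ∀ β ∈ front B T, m (insert (a * β) S) - m S ≤ 0 := fun β hβ =>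
    sub_nonpos.2 ((hpre β).trans_le (meanCoverTime_insert_le hlam hβ))
  let I : Finset M := (front B T).map (mulLeftEmbedding a).toEmbedding
  have hI : ∀ α ∈ I, m (insert α S) - m S ≤ 0 := by
    simp only [I, Finset.forall_mem_map]
    exact hdec
  have hloc : ∀ α ∈ front C S, α ∉ I → m (insert α S) = m S := fun α hα himg => by
    simp only [m]
    rw [← isLocal_meanCoverTime, preimage_insert_inter_of_notMem_image hα himg,
      isLocal_meanCoverTime]
  calc -1 ≤ localGenerator lam B (meanCoverTime lam B) T :=
        neg_one_le_localGenerator_meanCoverTime hlam T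
    _ ≤ ∑ β ∈ front B T, lam (a * β) * (m (insert (a * β) S) - m S) := by
        refine Finset.sum_le_sum fun β hβ => ?_
        rw [hpre]
        exact mul_le_mul_of_nonpos_right (hanti le_mul_self) (hpre β ▸ hdec β hβ)
    _ = ∑ α ∈ I, lam α * (m (insert α S) - m S) :=
        (Finset.sum_map (front B T) (mulLeftEmbedding a).toEmbedding
          fun α => lam α * (m (insert α S) - m S)).symm
    _ ≤ ∑ α ∈ I ∩ front C S, lam α * (m (insert α S) - m S) :=
        Finset.sum_le_sum_of_subset_of_nonpos' Finset.inter_subset_left fun α hα _ =>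
          mul_nonpos_of_nonneg_of_nonpos (hlam α).le (hI α hα)
    _ = localGenerator lam C m S := by
        refine Finset.sum_subset Finset.inter_subset_right fun α hα hαI => ?_
        rw [hloc α hα fun h => hαI (Finset.mem_inter.2 ⟨h, hα⟩), sub_self, mul_zero]

theorem meanCoverTime_translate_le (hlam : ∀ x, 0 < lam x) (hanti : Antitone lam)
    (haB : ∀ b ∈ B.carrier, a * b ∈ C.carrier) (hS : IsLowerSet S) :
    meanCoverTime lam B ((a * ·) ⁻¹' S) ≤ meanCoverTime lam C S := by
  refine le_of_localGenerator_le (B := C)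
    (u := fun T => meanCoverTime lam B ((a * ·) ⁻¹' T)) hlam (fun S hCS => ?_)
    (fun S _ hCS => ?_) hS
  · rw [meanCoverTime_of_subset hCS, meanCoverTime_of_subset (S := (a * ·) ⁻¹' S) fun b hb =>
      hCS (haB b hb)]
  · rw [localGenerator_meanCoverTime hlam hCS]
    exact neg_one_le_localGenerator_translate hlam hanti S

/-- Once `A` has been covered by its last element `α`, it remains to cover `α B`, of which only `α`
itself is present. -/
theorem meanCoverTime_add_le_of_not_subset (hlam : ∀ x, 0 < lam x) (hanti : Antitone lam)
    (hAC : A.carrier ⊆ C.carrier) (hABC : ∀ a ∈ A.carrier, ∀ b ∈ B.carrier, a * b ∈ C.carrier)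
    (hS : IsLowerSet S) (hAS : ¬ A.carrier ⊆ S) :
    meanCoverTime lam A S + meanCoverTime lam B {1} ≤ meanCoverTime lam C S := by
  induction S using front_induction C with
  | h S ih =>
  have hCS : ¬ C.carrier ⊆ S := fun h => hAS (hAC.trans h)
  refine le_of_localGenerator_le_of_insert_le
    (u := fun T => meanCoverTime lam A T + meanCoverTime lam B {1}) hlam hCS ?_ fun α hα => ?_
  · rw [localGenerator_meanCoverTime hlam hCS]
    refine (localGenerator_meanCoverTime hlam hAS).symm.trans_le (Eq.le ?_)
    rw [← localGenerator_eq_of_isLocal_of_subset isLocal_meanCoverTime hAC]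
    simp only [localGenerator, add_sub_add_right_eq_sub]
  have hαS : IsLowerSet (insert α S) := isLowerSet_insert hS hα
  by_cases h : A.carrier ⊆ insert α S
  · have hαA : α ∈ A.carrier := by_contra fun hαA =>
      hAS ((Set.subset_insert_iff_of_notMem hαA).1 h)
    have hpre : (α * ·) ⁻¹' insert α S = {1} := by
      ext y
      have hαy : α * y ∉ S := fun h => notMem_of_mem_front hα (hS le_self_mul h)
      simp [hαy]
    simp only [meanCoverTime_of_subset h, zero_add, ← hpre]
    exact meanCoverTime_translate_le hlam hanti (hABC α hαA) hαS
  · exact ih α hα hαS h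

theorem meanCoverTime_add_le (hlam : ∀ x, 0 < lam x) (hanti : Antitone lam)
    (hC : C.carrier = lowerMul A.carrier B.carrier) (hA1 : 1 ∈ A.carrier) (hB1 : 1 ∈ B.carrier) :
    meanCoverTime lam A ∅ + meanCoverTime lam B ∅ ≤ meanCoverTime lam C ∅ + 1 / lam 1 := by
  have hABC : ∀ a ∈ A.carrier, ∀ b ∈ B.carrier, a * b ∈ C.carrier := fun a ha b hb =>
    hC ▸ mul_mem_lowerMul ha hb
  have hle : meanCoverTime lam A ∅ + meanCoverTime lam B {1} ≤ meanCoverTime lam C ∅ :=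
    meanCoverTime_add_le_of_not_subset hlam hanti (hC ▸ subset_lowerMul hB1) hABC
      isLowerSet_empty fun h => h hA1
  rw [meanCoverTime_empty hlam hB1]
  linarith

end Superadditivity

/-! ### Dynkin's formula -/

section Dynamics

variable {P : Type*} [PartialOrder P]

theorem finite_growthElements (hfin : IsLocallyFinite P) (A : FinLowerSet P) :
    (growthElements A).Finite := by
  refine (hfin.2.1.union (A.finite.biUnion fun a _ => hfin.2.2 a)).subset fun x hx => ?_
  by_cases hmin : IsMin x
  · exact Or.inl hmin
  · obtain ⟨y, hy⟩ := exists_covBy_of_finite_Iic hfin.1 hmin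
    exact Or.inr (Set.mem_biUnion (by_contra fun hyA => hy.lt.not_ge (hx.2 hyA hy.le)) hy)

/-- The elements with at most `k` lower bounds. These sets exhaust the poset and are finite if it is
locally finite. -/
def level (P : Type*) [PartialOrder P] (k : ℕ) : Set P := {x | (Set.Iic x).ncard ≤ k}

theorem finite_level (hfin : IsLocallyFinite P) (k : ℕ) : (level P k).Finite := by
  induction k with
  | zero =>
    refine Set.finite_empty.subset fun x hx => ?_
    exact ((Set.ncard_pos (hfin.1 x)).2 ⟨x, le_rfl⟩).not_ge hx
  | succ k ih =>
    refine (hfin.2.1.union (ih.biUnion fun a _ => hfin.2.2 a)).subset fun x hx => ?_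
    by_cases hmin : IsMin x
    · exact Or.inl hmin
    · obtain ⟨y, hy⟩ := exists_covBy_of_finite_Iic hfin.1 hmin
      have hlt := Set.ncard_lt_ncard (Set.Iic_ssubset_Iic.2 hy.lt) (hfin.1 x)
      exact Or.inr (Set.mem_biUnion (x := y) (Nat.le_of_lt_succ (hlt.trans_le hx)) hy)

theorem eventually_subset_level {S : Set P} (hS : S.Finite) : ∀ᶠ k in atTop, S ⊆ level P k :=
  (hS.eventually_all (p := fun x k => x ∈ level P k)).2 fun _ _ => eventually_ge_atTop _

variable {B : FinLowerSet P} {D : Set P} {f : Set P → ℝ} {lam : P → ℝ}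

/-- The test function that agrees with `f` on the subsets of `D` and vanishes elsewhere. -/
def cutoff (D : Set P) (f : Set P → ℝ) (A : FinLowerSet P) : ℝ := (𝒫 D).indicator f A.carrier

theorem finite_support_cutoff (hD : D.Finite) (f : Set P → ℝ) :
    (Function.support (cutoff D f)).Finite :=
  (hD.finite_subsets.preimage fun _ _ _ _ h => FinLowerSet.ext h).subset fun _ hA =>
    Set.mem_of_indicator_ne_zero (s := 𝒫 D) hA

theorem abs_cutoff_le {c : ℝ} (hf : ∀ S, |f S| ≤ c) (A : FinLowerSet P) : |cutoff D f A| ≤ c :=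
  (norm_indicator_le_norm_self f A.carrier).trans (hf _)

theorem tendsto_cutoff_level (f : Set P → ℝ) (A : FinLowerSet P) :
    Tendsto (fun k => cutoff (level P k) f A) atTop (𝓝 (f A.carrier)) := by
  refine tendsto_const_nhds.congr' ?_
  filter_upwards [eventually_subset_level A.finite] with k hk
  exact (Set.indicator_of_mem (Set.mem_powerset hk) f).symm

theorem IsLocal.exists_abs_le (hf : IsLocal B f) : ∃ c, ∀ S, |f S| ≤ c := by
  obtain ⟨c, hc⟩ := (B.finite.finite_subsets.image fun S => |f S|).bddAbove
  refine ⟨c, fun S => ?_⟩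
  rw [← hf S]
  exact hc ⟨_, Set.inter_subset_right, rfl⟩

theorem generator_comp_carrier (hfin : IsLocallyFinite P) (f : Set P → ℝ) (A : FinLowerSet P) :
    generator lam (fun A => f A.carrier) A = ∑ α ∈ (finite_growthElements hfin A).toFinset,
      lam α * (f (insert α A.carrier) - f A.carrier) := by
  simp only [generator, FinLowerSet.grow]
  rw [finsum_set_coe_eq_finsum_mem (growthElements A)
    (f := fun α => lam α * (f (insert α A.carrier) - f A.carrier)),
    finsum_mem_eq_finite_toFinset_sum _ (finite_growthElements hfin A)]

theorem mem_front_iff_mem_growthElements {A : FinLowerSet P} {α : P} :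
    α ∈ front B A.carrier ↔ α ∈ B.carrier ∧ α ∈ growthElements A := by
  rw [mem_front, growthElements, Set.mem_ofPred, minimal_iff_forall_lt]
  simp only [not_not]

theorem generator_comp_carrier_of_isLocal (hfin : IsLocallyFinite P) (hf : IsLocal B f)
    (A : FinLowerSet P) :
    generator lam (fun A => f A.carrier) A = localGenerator lam B f A.carrier := by
  rw [generator_comp_carrier hfin]
  refine (Finset.sum_subset (fun α hα => ?_) fun α hα hαB => ?_).symm
  · exact (Set.Finite.mem_toFinset _).2 (mem_front_iff_mem_growthElements.1 hα).2
  · have hα' : α ∉ B.carrier := fun hB => hαB (mem_front_iff_mem_growthElements.2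
      ⟨hB, (Set.Finite.mem_toFinset _).1 hα⟩)
    rw [hf.insert_of_notMem hα', sub_self, mul_zero]

/-- The rate at which the process jumps from `A` out of the set of subsets of `D`. -/
def exitRate (lam : P → ℝ) (D : Set P) (A : FinLowerSet P) : ℝ := -generator lam (cutoff D 1) A

theorem exitRate_eq_sum (hfin : IsLocallyFinite P) (D : Set P) (A : FinLowerSet P) :
    exitRate lam D A = ∑ α ∈ (finite_growthElements hfin A).toFinset,
      lam α * ((𝒫 D).indicator 1 A.carrier - (𝒫 D).indicator 1 (insert α A.carrier)) := by
  rw [exitRate, show cutoff D 1 = fun A => (𝒫 D).indicator 1 A.carrier from rfl,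
    generator_comp_carrier hfin, ← Finset.sum_neg_distrib]
  exact Finset.sum_congr rfl fun _ _ => by ring

theorem insert_notMem_powerset {α : Type*} {s t : Set α} (h : s ∉ 𝒫 t) (a : α) :
    insert a s ∉ 𝒫 t :=
  fun ha => h ((Set.subset_insert a s).trans ha)

theorem exitRate_nonneg (hlam : ∀ x, 0 < lam x) (hfin : IsLocallyFinite P) (D : Set P)
    (A : FinLowerSet P) : 0 ≤ exitRate lam D A := by
  rw [exitRate_eq_sum hfin]
  refine Finset.sum_nonneg fun α _ => mul_nonneg (hlam α).le (sub_nonneg.2 ?_)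
  by_cases hA : A.carrier ∈ 𝒫 D
  · rw [Set.indicator_of_mem hA]
    exact Set.indicator_le_self' (fun _ _ => zero_le_one) _
  · rw [Set.indicator_of_notMem hA, Set.indicator_of_notMem (insert_notMem_powerset hA α)]

theorem exists_abs_exitRate_le (hfin : IsLocallyFinite P) (hD : D.Finite) :
    ∃ c, ∀ A, |exitRate lam D A| ≤ c := by
  obtain ⟨c, hc⟩ := ((finite_support_cutoff hD 1).image fun A => |exitRate lam D A|).bddAbove
  refine ⟨max c 0, fun A => ?_⟩
  by_cases hA : A.carrier ∈ 𝒫 D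
  · exact (hc ⟨A, by simp [cutoff, hA], rfl⟩).trans (le_max_left _ _)
  · rw [exitRate_eq_sum hfin, Finset.sum_eq_zero fun α _ => ?_, abs_zero]
    · exact le_max_right _ _
    · rw [Set.indicator_of_notMem hA, Set.indicator_of_notMem (insert_notMem_powerset hA α),
        sub_self, mul_zero]

theorem generator_cutoff (hfin : IsLocallyFinite P) (hBD : B.carrier ⊆ D) (hf : IsLocal B f)
    (A : FinLowerSet P) : generator lam (cutoff D f) A =
      cutoff D (localGenerator lam B f) A - f A.carrier * exitRate lam D A := by
  rw [show cutoff D f = fun A => (𝒫 D).indicator f A.carrier from rfl,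
    generator_comp_carrier hfin, exitRate_eq_sum hfin, cutoff, Finset.mul_sum]
  by_cases hA : A.carrier ∈ 𝒫 D
  · rw [Set.indicator_of_mem hA, Set.indicator_of_mem hA,
      ← generator_comp_carrier_of_isLocal hfin hf, generator_comp_carrier hfin,
      ← Finset.sum_sub_distrib]
    refine Finset.sum_congr rfl fun α _ => ?_
    by_cases hα : insert α A.carrier ∈ 𝒫 D
    · simp [hA, hα]
    · have hα' : α ∉ B.carrier := fun h => hα (Set.insert_subset (hBD h) hA)
      simp only [Set.indicator_of_mem hA, Set.indicator_of_notMem hα, hf.insert_of_notMem hα',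
        Pi.one_apply]
      ring
  · simp only [Set.indicator_of_notMem hA, Set.indicator_of_notMem (insert_notMem_powerset hA _),
      sub_self, mul_zero, Finset.sum_const_zero]

/-- The point to the right of `s` on the grid of mesh `1 / (n + 1)`. -/
def gridTime (n : ℕ) (s : ℝ≥0) : ℝ≥0 := (⌊((n : ℝ≥0) + 1) * s⌋₊ + 1) / ((n : ℝ≥0) + 1)

theorem tendsto_gridTime (s : ℝ≥0) : Tendsto (fun n => gridTime n s) atTop (𝓝[>] s) := by
  have lt_gridTime (n : ℕ) : s < gridTime n s := by
    rw [gridTime, lt_div_iff₀ (by positivity), mul_comm]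
    exact Nat.lt_floor_add_one _
  have gridTime_le (n : ℕ) : gridTime n s ≤ s + 1 / ((n : ℝ≥0) + 1) := by
    rw [gridTime, add_div]
    gcongr
    rw [div_le_iff₀ (by positivity), mul_comm s]
    exact Nat.floor_le zero_le
  refine tendsto_nhdsWithin_of_tendsto_nhds_of_eventually_within _ ?_ (.of_forall lt_gridTime)
  refine tendsto_of_tendsto_of_tendsto_of_le_of_le tendsto_const_nhds ?_
    (fun n => (lt_gridTime n).le) gridTime_le
  simpa using tendsto_const_nhds.add (tendsto_one_div_add_atTop_nhds_zero_nat (𝕜 := ℝ≥0))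

variable {Ω : Type*} {X : ℝ≥0 → Ω → FinLowerSet P} {g : FinLowerSet P → ℝ}
  {x : ℝ≥0 → FinLowerSet P} {c : ℝ}

theorem tendsto_comp_gridTime (hx : ∀ t, ∀ᶠ s in 𝓝[>] t, x s = x t) (g : FinLowerSet P → ℝ)
    (s : ℝ≥0) : Tendsto (fun n => g (x (gridTime n s))) atTop (𝓝 (g (x s))) := by
  refine tendsto_const_nhds.congr' ?_
  filter_upwards [(tendsto_gridTime s).eventually (hx s)] with n hn
  rw [hn]

theorem measurable_gridIndex (n : ℕ) :
    Measurable fun s : ℝ => ⌊((n : ℝ≥0) + 1) * s.toNNReal⌋₊ :=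
  Nat.measurable_floor.comp (measurable_real_toNNReal.const_mul _)

theorem measurable_path (hx : ∀ t, ∀ᶠ s in 𝓝[>] t, x s = x t) (g : FinLowerSet P → ℝ) :
    Measurable fun s : ℝ => g (x s.toNNReal) := by
  refine measurable_of_tendsto_metrizable (f := fun n (s : ℝ) => g (x (gridTime n s.toNNReal)))
    (fun n => ?_) (tendsto_pi_nhds.2 fun s => tendsto_comp_gridTime hx g _)
  exact (measurable_from_top (f := fun m : ℕ => g (x ((m + 1) / ((n : ℝ≥0) + 1))))).comp
    (measurable_gridIndex n)

theorem intervalIntegrable_path (hx : ∀ t, ∀ᶠ s in 𝓝[>] t, x s = x t) (hg : ∀ A, |g A| ≤ c)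
    (a b : ℝ) : IntervalIntegrable (fun s => g (x s.toNNReal)) volume a b :=
  (intervalIntegrable_const (c := c)).mono_fun' (measurable_path hx g).aestronglyMeasurable
    (.of_forall fun _ => hg _)

/-- The integral of `g` along the path of the process up to time `t`. -/
def timeIntegral (X : ℝ≥0 → Ω → FinLowerSet P) (g : FinLowerSet P → ℝ) (t : ℝ≥0) (ω : Ω) : ℝ :=
  ∫ s in (0 : ℝ)..t, g (X s.toNNReal ω)

theorem timeIntegral_zero (g : FinLowerSet P → ℝ) (ω : Ω) : timeIntegral X g 0 ω = 0 :=
  intervalIntegral.integral_same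

theorem timeIntegral_nonneg (hg : ∀ A, 0 ≤ g A) (t : ℝ≥0) (ω : Ω) : 0 ≤ timeIntegral X g t ω :=
  intervalIntegral.integral_nonneg t.coe_nonneg fun _ _ => hg _

theorem timeIntegral_neg (g : FinLowerSet P → ℝ) (t : ℝ≥0) (ω : Ω) :
    timeIntegral X (fun A => -g A) t ω = -timeIntegral X g t ω :=
  intervalIntegral.integral_neg

theorem timeIntegral_const_mul (a : ℝ) (g : FinLowerSet P → ℝ) (t : ℝ≥0) (ω : Ω) :
    timeIntegral X (fun A => a * g A) t ω = a * timeIntegral X g t ω :=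
  intervalIntegral.integral_const_mul _ _

theorem abs_timeIntegral_le (hg : ∀ A, |g A| ≤ c) (t : ℝ≥0) (ω : Ω) :
    |timeIntegral X g t ω| ≤ c * t := by
  have hnorm (r : ℝ) : ‖g (X r.toNNReal ω)‖ ≤ c := hg _
  simpa [timeIntegral] using intervalIntegral.norm_integral_le_of_norm_le_const (a := 0)
    (b := (t : ℝ)) fun r _ => hnorm r

theorem timeIntegral_sub {ω : Ω} (hω : ∀ t, ∀ᶠ s in 𝓝[>] t, X s ω = X t ω) {r : FinLowerSet P → ℝ}
    {d : ℝ} (hg : ∀ A, |g A| ≤ c) (hr : ∀ A, |r A| ≤ d) (t : ℝ≥0) :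
    timeIntegral X (fun A => g A - r A) t ω = timeIntegral X g t ω - timeIntegral X r t ω :=
  intervalIntegral.integral_sub (intervalIntegrable_path (x := fun t => X t ω) hω hg _ _)
    (intervalIntegrable_path (x := fun t => X t ω) hω hr _ _)

theorem timeIntegral_antitone_of_nonpos {ω : Ω} (hω : ∀ t, ∀ᶠ s in 𝓝[>] t, X s ω = X t ω)
    (hg : ∀ A, |g A| ≤ c) (hg0 : ∀ A, g A ≤ 0) :
    Antitone fun t => timeIntegral X g t ω := by
  intro s t hst
  have hi := intervalIntegrable_path (x := fun t => X t ω) hω hg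
  simp only [timeIntegral]
  rw [← intervalIntegral.integral_add_adjacent_intervals (hi 0 s) (hi s t)]
  refine add_le_of_nonpos_right ?_
  rw [intervalIntegral.integral_of_le (by exact_mod_cast hst)]
  exact integral_nonpos fun _ => hg0 _

variable [mΩ : MeasurableSpace Ω] {μ : Measure Ω} {ℱ : Filtration ℝ≥0 mΩ}

namespace IsGrowthProcess

theorem measurable_comp (hX : IsGrowthProcess lam μ ℱ X) (g : FinLowerSet P → ℝ) (t : ℝ≥0) :
    Measurable fun ω => g (X t ω) :=
  measurable_from_top.comp ((hX.adapted t).mono (ℱ.le t) le_rfl)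

theorem aestronglyMeasurable_prod (hX : IsGrowthProcess lam μ ℱ X) (g : FinLowerSet P → ℝ)
    (ν : Measure ℝ) [SFinite ν] :
    AEStronglyMeasurable (fun p : ℝ × Ω => g (X p.1.toNNReal p.2)) (ν.prod μ) := by
  refine aestronglyMeasurable_of_tendsto_ae atTop
    (f := fun n (p : ℝ × Ω) => g (X (gridTime n p.1.toNNReal) p.2)) (fun n => ?_) ?_
  · have hgrid : Measurable fun p : ℕ × Ω => g (X ((p.1 + 1) / ((n : ℝ≥0) + 1)) p.2) :=
      measurable_from_prod_countable_right fun m =>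
        hX.measurable_comp g ((m + 1) / ((n : ℝ≥0) + 1))
    exact (hgrid.comp (((measurable_gridIndex n).comp measurable_fst).prodMk
      measurable_snd)).aestronglyMeasurable
  · filter_upwards [Measure.quasiMeasurePreserving_snd.ae hX.rightCts] with p hp
    exact tendsto_comp_gridTime hp g _

variable [IsProbabilityMeasure μ]

theorem integrable_comp (hX : IsGrowthProcess lam μ ℱ X) (hg : ∀ A, |g A| ≤ c) (t : ℝ≥0) :
    Integrable (fun ω => g (X t ω)) μ :=
  .of_bound (hX.measurable_comp g t).aestronglyMeasurable c (.of_forall fun _ => hg _)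

theorem integrable_prod (hX : IsGrowthProcess lam μ ℱ X) (hg : ∀ A, |g A| ≤ c) (ν : Measure ℝ)
    [IsFiniteMeasure ν] : Integrable (fun p : ℝ × Ω => g (X p.1.toNNReal p.2)) (ν.prod μ) :=
  .of_bound (hX.aestronglyMeasurable_prod g ν) c (.of_forall fun _ => hg _)

theorem integrable_timeIntegral (hX : IsGrowthProcess lam μ ℱ X) (hg : ∀ A, |g A| ≤ c)
    (t : ℝ≥0) : Integrable (timeIntegral X g t) μ := by
  unfold timeIntegral
  simp only [intervalIntegral.integral_of_le t.coe_nonneg]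
  exact (hX.integrable_prod hg (volume.restrict (Set.Ioc 0 (t : ℝ)))).integral_prod_right

theorem integrable_sub_timeIntegral (hX : IsGrowthProcess lam μ ℱ X) {r : FinLowerSet P → ℝ}
    {d : ℝ} (hg : ∀ A, |g A| ≤ c) (hr : ∀ A, |r A| ≤ d) (t : ℝ≥0) :
    Integrable (fun ω => g (X t ω) - timeIntegral X r t ω) μ :=
  (hX.integrable_comp hg t).sub (hX.integrable_timeIntegral hr t)

theorem integral_initial (hX : IsGrowthProcess lam μ ℱ X) (g : FinLowerSet P → ℝ) :
    ∫ ω, g (X 0 ω) ∂μ = g .empty := by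
  rw [integral_congr_ae (hX.initial.mono fun ω hω => congrArg g hω)]
  simp

theorem setIntegral_eq_of_finite_support (hX : IsGrowthProcess lam μ ℱ X)
    (hg : (Function.support g).Finite) {s t : ℝ≥0} (hst : s ≤ t) {F : Set Ω}
    (hF : MeasurableSet[ℱ s] F) :
    ∫ ω in F, (g (X s ω) - timeIntegral X (generator lam g) s ω) ∂μ =
      ∫ ω in F, (g (X t ω) - timeIntegral X (generator lam g) t ω) ∂μ :=
  (hX.martingale g hg).setIntegral_eq hst hF

theorem integral_timeIntegral_exitRate (hX : IsGrowthProcess lam μ ℱ X) (hfin : IsLocallyFinite P)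
    (hD : D.Finite) (t : ℝ≥0) :
    ∫ ω, timeIntegral X (exitRate lam D) t ω ∂μ = 1 - ∫ ω, cutoff D 1 (X t ω) ∂μ := by
  obtain ⟨c, hc⟩ := exists_abs_exitRate_le (lam := lam) hfin hD
  have hcut : ∀ A, |cutoff D 1 A| ≤ 1 := abs_cutoff_le fun _ => by simp
  have hinit : cutoff D 1 .empty = 1 := Set.indicator_of_mem (Set.empty_subset D) _
  have hneg (ω : Ω) : timeIntegral X (generator lam (cutoff D 1)) t ω =
      -timeIntegral X (exitRate lam D) t ω := by
    rw [← timeIntegral_neg]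
    simp only [exitRate, neg_neg]
  have hmart := hX.setIntegral_eq_of_finite_support (finite_support_cutoff hD 1)
    (zero_le (a := t)) MeasurableSet.univ
  simp only [Measure.restrict_univ, timeIntegral_zero, hneg, sub_neg_eq_add, sub_zero] at hmart
  rw [hX.integral_initial, hinit,
    integral_add (hX.integrable_comp hcut t) (hX.integrable_timeIntegral hc t)] at hmart
  linarith

/-- The process does not explode, because its values are finite sets at all times. -/
theorem tendsto_integral_exitRate (hX : IsGrowthProcess lam μ ℱ X) (hfin : IsLocallyFinite P)
    (t : ℝ≥0) : Tendsto (fun k => ∫ ω, timeIntegral X (exitRate lam (level P k)) t ω ∂μ) atTop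
      (𝓝 0) := by
  have hlim : Tendsto (fun k => ∫ ω, cutoff (level P k) 1 (X t ω) ∂μ) atTop
      (𝓝 (∫ _, (1 : ℝ) ∂μ)) :=
    tendsto_integral_of_dominated_convergence (fun _ => 1)
      (fun k => (hX.measurable_comp _ t).aestronglyMeasurable) (integrable_const _)
      (fun k => .of_forall fun ω => abs_cutoff_le (fun _ => by simp) _)
      (.of_forall fun ω => tendsto_cutoff_level 1 _)
  simp only [hX.integral_timeIntegral_exitRate hfin (finite_level hfin _)]
  simpa using (tendsto_const_nhds (x := (1 : ℝ))).sub hlim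

theorem tendsto_setIntegral_cutoff_level (hX : IsGrowthProcess lam μ ℱ X) {f q : Set P → ℝ}
    {d : ℝ} (hf : ∀ S, |f S| ≤ c) (hq : ∀ S, |q S| ≤ d) (t : ℝ≥0) (F : Set Ω) :
    Tendsto (fun k => ∫ ω in F, (cutoff (level P k) f (X t ω) -
      timeIntegral X (cutoff (level P k) q) t ω) ∂μ) atTop
      (𝓝 (∫ ω in F, (f (X t ω).carrier - timeIntegral X (fun A => q A.carrier) t ω) ∂μ)) := by
  refine tendsto_integral_of_dominated_convergence (fun _ => c + d * t)
    (fun k => ?_) (integrable_const _) (fun k => .of_forall fun ω => ?_) ?_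
  · exact (hX.integrable_sub_timeIntegral (abs_cutoff_le hf)
      (abs_cutoff_le hq) t).aestronglyMeasurable.restrict
  · exact (norm_sub_le _ _).trans (add_le_add (abs_cutoff_le hf _)
      (abs_timeIntegral_le (abs_cutoff_le hq) t ω))
  · filter_upwards [ae_restrict_of_ae hX.rightCts] with ω hω
    refine (tendsto_cutoff_level f _).sub ?_
    exact intervalIntegral.tendsto_integral_filter_of_dominated_convergence (fun _ => d)
      (.of_forall fun k => (measurable_path (x := fun t => X t ω) hω _).aestronglyMeasurable)
      (.of_forall fun k => .of_forall fun r _ => abs_cutoff_le hq _)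
      intervalIntegrable_const (.of_forall fun r _ => tendsto_cutoff_level q _)

theorem abs_setIntegral_timeIntegral_mul_le (hX : IsGrowthProcess lam μ ℱ X)
    {g r : FinLowerSet P → ℝ} {d : ℝ} (hg : ∀ A, |g A| ≤ c) (hr : ∀ A, |r A| ≤ d)
    (hr0 : ∀ A, 0 ≤ r A) (t : ℝ≥0) (F : Set Ω) :
    |∫ ω in F, timeIntegral X (fun A => g A * r A) t ω ∂μ| ≤
      c * ∫ ω, timeIntegral X r t ω ∂μ := by
  have hc0 : 0 ≤ c := (abs_nonneg _).trans (hg .empty)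
  have hint := (hX.integrable_timeIntegral hr t).const_mul c
  calc |∫ ω in F, timeIntegral X (fun A => g A * r A) t ω ∂μ|
      ≤ ∫ ω in F, c * timeIntegral X r t ω ∂μ := by
        rw [← Real.norm_eq_abs]
        refine norm_integral_le_of_norm_le hint.restrict ?_
        filter_upwards [ae_restrict_of_ae hX.rightCts] with ω hω
        rw [← timeIntegral_const_mul, timeIntegral, timeIntegral]
        have hint_path := intervalIntegrable_path (x := fun t => X t ω) hω hr 0 t
        refine intervalIntegral.norm_integral_le_of_norm_le t.coe_nonneg (.of_forall fun s _ => ?_)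
          (hint_path.const_mul c)
        rw [norm_mul, Real.norm_of_nonneg (hr0 _)]
        exact mul_le_mul_of_nonneg_right (hg _) (hr0 _)
    _ ≤ ∫ ω, c * timeIntegral X r t ω ∂μ :=
        setIntegral_le_integral hint
          (.of_forall fun ω => mul_nonneg hc0 (timeIntegral_nonneg hr0 t ω))
    _ = c * ∫ ω, timeIntegral X r t ω ∂μ := integral_const_mul _ _

theorem tendsto_setIntegral_generator_cutoff_level (hX : IsGrowthProcess lam μ ℱ X)
    (hlam : ∀ x, 0 < lam x) (hfin : IsLocallyFinite P) (hf : IsLocal B f) (t : ℝ≥0) (F : Set Ω) :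
    Tendsto (fun k => ∫ ω in F, (cutoff (level P k) f (X t ω) -
      timeIntegral X (generator lam (cutoff (level P k) f)) t ω) ∂μ) atTop
      (𝓝 (∫ ω in F, (f (X t ω).carrier -
        timeIntegral X (fun A => localGenerator lam B f A.carrier) t ω) ∂μ)) := by
  obtain ⟨c, hc⟩ := hf.exists_abs_le
  obtain ⟨d, hd⟩ := (hf.localGenerator (lam := lam)).exists_abs_le
  choose e he using fun k => exists_abs_exitRate_le (lam := lam) hfin (finite_level hfin k)
  have herr : Tendsto (fun k => ∫ ω in F, timeIntegral X
      (fun A => f A.carrier * exitRate lam (level P k) A) t ω ∂μ) atTop (𝓝 0) := by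
    refine squeeze_zero_norm (fun k => hX.abs_setIntegral_timeIntegral_mul_le
      (fun A => hc A.carrier) (he k) (exitRate_nonneg hlam hfin _) t F) ?_
    simpa using (hX.tendsto_integral_exitRate hfin t).const_mul c
  refine add_zero (∫ ω in F, (f (X t ω).carrier - _) ∂μ) ▸
    ((hX.tendsto_setIntegral_cutoff_level hc hd t F).add herr).congr' ?_
  filter_upwards [eventually_subset_level B.finite] with k hk
  have hmul (A : FinLowerSet P) : |f A.carrier * exitRate lam (level P k) A| ≤ c * e k := by
    rw [abs_mul]
    exact mul_le_mul (hc _) (he k A) (abs_nonneg _) ((abs_nonneg _).trans (hc A.carrier))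
  rw [← integral_add
    (hX.integrable_sub_timeIntegral (abs_cutoff_le hc) (abs_cutoff_le hd) t).restrict
    (hX.integrable_timeIntegral hmul t).restrict]
  refine integral_congr_ae ?_
  filter_upwards [ae_restrict_of_ae hX.rightCts] with ω hω
  rw [funext (generator_cutoff hfin hk hf), timeIntegral_sub hω (abs_cutoff_le hd) hmul]
  ring

theorem setIntegral_eq_of_isLocal (hX : IsGrowthProcess lam μ ℱ X) (hlam : ∀ x, 0 < lam x)
    (hfin : IsLocallyFinite P) (hf : IsLocal B f) {s t : ℝ≥0} (hst : s ≤ t) {F : Set Ω}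
    (hF : MeasurableSet[ℱ s] F) :
    ∫ ω in F, (f (X s ω).carrier -
        timeIntegral X (fun A => localGenerator lam B f A.carrier) s ω) ∂μ =
      ∫ ω in F, (f (X t ω).carrier -
        timeIntegral X (fun A => localGenerator lam B f A.carrier) t ω) ∂μ := by
  refine tendsto_nhds_unique
    ((hX.tendsto_setIntegral_generator_cutoff_level hlam hfin hf s F).congr fun k => ?_)
    (hX.tendsto_setIntegral_generator_cutoff_level hlam hfin hf t F)
  exact hX.setIntegral_eq_of_finite_support (finite_support_cutoff (finite_level hfin k) f) hst hF

theorem integral_comp_eq_of_isLocal (hX : IsGrowthProcess lam μ ℱ X) (hlam : ∀ x, 0 < lam x)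
    (hfin : IsLocallyFinite P) (hf : IsLocal B f) (t : ℝ≥0) :
    ∫ ω, f (X t ω).carrier ∂μ =
      f ∅ + ∫ ω, timeIntegral X (fun A => localGenerator lam B f A.carrier) t ω ∂μ := by
  obtain ⟨c, hc⟩ := hf.exists_abs_le
  obtain ⟨d, hd⟩ := (hf.localGenerator (lam := lam)).exists_abs_le
  have hmart := hX.setIntegral_eq_of_isLocal hlam hfin hf (zero_le (a := t)) MeasurableSet.univ
  simp only [Measure.restrict_univ, timeIntegral_zero, sub_zero] at hmart
  rw [hX.integral_initial fun A => f A.carrier,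
    integral_sub (hX.integrable_comp (fun A => hc A.carrier) t)
      (hX.integrable_timeIntegral (fun A => hd A.carrier) t)] at hmart
  exact (eq_add_of_sub_eq hmart.symm).trans rfl

end IsGrowthProcess

end Dynamics

/-! ### The covering time -/

section CoverTime

variable {P : Type*} [PartialOrder P] {lam : P → ℝ} {B : FinLowerSet P}

/-- The indicator of the sets that do not contain `B`. -/
def uncovered (B : FinLowerSet P) : Set P → ℝ := {S | ¬B.carrier ⊆ S}.indicator 1

theorem uncovered_of_subset {S : Set P} (h : B.carrier ⊆ S) : uncovered B S = 0 :=
  Set.indicator_of_notMem (not_not.2 h) 1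

theorem uncovered_of_not_subset {S : Set P} (h : ¬B.carrier ⊆ S) : uncovered B S = 1 :=
  Set.indicator_of_mem (s := {S | ¬B.carrier ⊆ S}) h 1

theorem uncovered_nonneg (S : Set P) : 0 ≤ uncovered B S :=
  Set.indicator_nonneg (fun _ _ => zero_le_one) S

theorem abs_uncovered_le (S : Set P) : |uncovered B S| ≤ 1 := by
  rw [abs_of_nonneg (uncovered_nonneg S)]
  exact Set.indicator_le_self' (fun _ _ => zero_le_one) S

theorem uncovered_antitone : Antitone (uncovered B) := fun S T hST => by
  by_cases hS : B.carrier ⊆ S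
  · rw [uncovered_of_subset (hS.trans hST)]
    exact uncovered_nonneg S
  · rw [uncovered_of_not_subset hS]
    exact (le_abs_self _).trans (abs_uncovered_le T)

theorem isLocal_uncovered : IsLocal B (uncovered B) := fun S => by
  by_cases hS : B.carrier ⊆ S
  · rw [uncovered_of_subset hS, uncovered_of_subset (Set.subset_inter hS subset_rfl)]
  · rw [uncovered_of_not_subset hS,
      uncovered_of_not_subset fun h => hS (h.trans Set.inter_subset_left)]

theorem localGenerator_uncovered_nonpos (hlam : ∀ x, 0 < lam x) (S : Set P) :
    localGenerator lam B (uncovered B) S ≤ 0 :=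
  Finset.sum_nonpos fun α _ => mul_nonpos_of_nonneg_of_nonpos (hlam α).le
    (sub_nonpos.2 (uncovered_antitone (Set.subset_insert α S)))

theorem localGenerator_meanCoverTime_eq_neg_uncovered (hlam : ∀ x, 0 < lam x) (S : Set P) :
    localGenerator lam B (meanCoverTime lam B) S = -uncovered B S := by
  by_cases hS : B.carrier ⊆ S
  · rw [localGenerator_of_subset hS, uncovered_of_subset hS, neg_zero]
  · rw [localGenerator_meanCoverTime hlam hS, uncovered_of_not_subset hS]

variable {Ω : Type*} {X : ℝ≥0 → Ω → FinLowerSet P} {ω : Ω}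

theorem coverTime_le_iff {S : Set P} (hω : ∀ t, ∀ᶠ s in 𝓝[>] t, X s ω = X t ω)
    (hmono : ∀ s t, s ≤ t → S ⊆ (X s ω).carrier → S ⊆ (X t ω).carrier) (t : ℝ≥0) :
    coverTime X S ω ≤ t ↔ S ⊆ (X t ω).carrier := by
  refine ⟨fun hle => by_contra fun hS => ?_, fun hS => iInf₂_le t hS⟩
  obtain ⟨u, hu, htu⟩ := ((hω t).and self_mem_nhdsWithin).exists
  have hule : (u : ℝ≥0∞) ≤ coverTime X S ω := le_iInf₂ fun s hs => by
    by_contra! hsu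
    exact hS (hu ▸ hmono s u (by exact_mod_cast hsu.le) hs)
  exact (hule.trans hle).not_gt (by exact_mod_cast htu)

/-- The time that the process spends up to time `t` in states that do not contain `B`, which is
almost surely `min t τ_B`. -/
def uncoveredTime (X : ℝ≥0 → Ω → FinLowerSet P) (B : FinLowerSet P) : ℝ≥0 → Ω → ℝ :=
  timeIntegral X fun A => uncovered B A.carrier

theorem uncoveredTime_eq_toReal_min
    (hω : ∀ t : ℝ≥0, coverTime X B.carrier ω ≤ t ↔ B.carrier ⊆ (X t ω).carrier) (t : ℝ≥0) :
    uncoveredTime X B t ω = (min (t : ℝ≥0∞) (coverTime X B.carrier ω)).toReal := by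
  set τ := coverTime X B.carrier ω
  set m := (min (t : ℝ≥0∞) τ).toReal with hm
  have htop : min (t : ℝ≥0∞) τ ≠ ∞ := ((min_le_left _ _).trans_lt ENNReal.coe_lt_top).ne
  have hmt : m ≤ t := by
    simpa using ENNReal.toReal_mono ENNReal.coe_ne_top (min_le_left (t : ℝ≥0∞) τ)
  have huncovered : ∀ s : ℝ, s ≠ m → s ∈ Set.Ioc 0 (t : ℝ) →
      uncovered B (X s.toNNReal ω).carrier = {s | s ≤ m}.indicator 1 s := by
    intro s hsm hs
    have hst : ENNReal.ofReal s ≤ t := ENNReal.ofReal_le_coe.2 hs.2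
    have hle : s ≤ m ↔ ENNReal.ofReal s ≤ τ := by
      rw [hm, ← ENNReal.ofReal_le_iff_le_toReal htop, le_min_iff, and_iff_right hst]
    by_cases hcov : τ ≤ ENNReal.ofReal s
    · rw [uncovered_of_subset ((hω _).1 hcov)]
      refine (Set.indicator_of_notMem (fun hsm' => hsm ?_) _).symm
      rw [hm, min_eq_right (hcov.trans hst), hcov.antisymm (hle.1 hsm'),
        ENNReal.toReal_ofReal hs.1.le]
    · rw [uncovered_of_not_subset fun h => hcov ((hω _).2 h)]
      exact (Set.indicator_of_mem (s := {s | s ≤ m}) (hle.2 (not_le.1 hcov).le) 1).symm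
  calc uncoveredTime X B t ω = ∫ s in (0 : ℝ)..t, {s | s ≤ m}.indicator 1 s := by
        refine intervalIntegral.integral_congr_ae ?_
        filter_upwards [Measure.ae_ne volume m] with s hsm hs
        exact huncovered s hsm (Set.uIoc_of_le t.coe_nonneg ▸ hs)
    _ = m := by
        rw [intervalIntegral.integral_indicator ⟨ENNReal.toReal_nonneg, hmt⟩]
        simp [hm]

theorem tendsto_natCast_min (x : ℝ≥0∞) :
    Tendsto (fun n : ℕ => min (((n : ℝ≥0) : ℝ≥0∞)) x) atTop (𝓝 x) := by
  simpa using ENNReal.tendsto_nat_nhds_top.min (tendsto_const_nhds (x := x))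

theorem lintegral_le_of_tendsto {α : Type*} [MeasurableSpace α] {μ : Measure α}
    {f : ℕ → α → ℝ≥0∞} {g : α → ℝ≥0∞} {K : ℝ≥0∞} (hf : ∀ n, AEMeasurable (f n) μ)
    (hlim : ∀ᵐ x ∂μ, Tendsto (fun n => f n x) atTop (𝓝 (g x))) (hK : ∀ n, ∫⁻ x, f n x ∂μ ≤ K) :
    ∫⁻ x, g x ∂μ ≤ K := by
  calc ∫⁻ x, g x ∂μ = ∫⁻ x, liminf (fun n => f n x) atTop ∂μ :=
        lintegral_congr_ae (hlim.mono fun x hx => hx.liminf_eq.symm)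
    _ ≤ liminf (fun n => ∫⁻ x, f n x ∂μ) atTop := lintegral_liminf_le' hf
    _ ≤ K := liminf_le_of_frequently_le' (.of_forall hK)

variable [mΩ : MeasurableSpace Ω] {μ : Measure Ω} [IsProbabilityMeasure μ] {ℱ : Filtration ℝ≥0 mΩ}

namespace IsGrowthProcess

theorem setIntegral_uncovered_antitone (hX : IsGrowthProcess lam μ ℱ X) (hlam : ∀ x, 0 < lam x)
    (hfin : IsLocallyFinite P) {s t : ℝ≥0} (hst : s ≤ t) {F : Set Ω} (hF : MeasurableSet[ℱ s] F) :
    ∫ ω in F, uncovered B (X t ω).carrier ∂μ ≤ ∫ ω in F, uncovered B (X s ω).carrier ∂μ := by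
  obtain ⟨d, hd⟩ := (isLocal_uncovered.localGenerator (B := B) (lam := lam)).exists_abs_le
  have hint (u : ℝ≥0) : Integrable (fun ω => uncovered B (X u ω).carrier) μ :=
    hX.integrable_comp (fun A => abs_uncovered_le A.carrier) u
  have hint_gen (u : ℝ≥0) : Integrable
      (timeIntegral X (fun A => localGenerator lam B (uncovered B) A.carrier) u) μ :=
    hX.integrable_timeIntegral (fun A => hd A.carrier) u
  have hmart := hX.setIntegral_eq_of_isLocal hlam hfin isLocal_uncovered (B := B) hst hF
  rw [integral_sub (hint s).restrict (hint_gen s).restrict,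
    integral_sub (hint t).restrict (hint_gen t).restrict] at hmart
  have hgen := setIntegral_mono_ae (s := F) (hint_gen t).restrict (hint_gen s).restrict
    (hX.rightCts.mono fun ω hω => timeIntegral_antitone_of_nonpos hω (fun A => hd A.carrier)
      (fun A => localGenerator_uncovered_nonpos hlam A.carrier) hst)
  linarith

theorem ae_subset_of_le (hX : IsGrowthProcess lam μ ℱ X) (hlam : ∀ x, 0 < lam x)
    (hfin : IsLocallyFinite P) (B : FinLowerSet P) {s t : ℝ≥0} (hst : s ≤ t) :
    ∀ᵐ ω ∂μ, B.carrier ⊆ (X s ω).carrier → B.carrier ⊆ (X t ω).carrier := by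
  set F : Set Ω := {ω | B.carrier ⊆ (X s ω).carrier}
  have hF : MeasurableSet[ℱ s] F :=
    hX.adapted s (show MeasurableSet {A : FinLowerSet P | B.carrier ⊆ A.carrier} from trivial)
  have hs : ∫ ω in F, uncovered B (X s ω).carrier ∂μ = 0 :=
    setIntegral_eq_zero_of_forall_eq_zero fun ω hω => uncovered_of_subset hω
  have ht : ∫ ω in F, uncovered B (X t ω).carrier ∂μ = 0 :=
    ((hX.setIntegral_uncovered_antitone hlam hfin hst hF).trans_eq hs).antisymm
      (integral_nonneg fun ω => uncovered_nonneg _)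
  rw [integral_eq_zero_iff_of_nonneg (fun ω => uncovered_nonneg _)
    (hX.integrable_comp (fun A => abs_uncovered_le A.carrier) t).restrict, EventuallyEq,
    ae_restrict_iff' (ℱ.le s _ hF)] at ht
  filter_upwards [ht] with ω hω hωF
  by_contra hcon
  exact one_ne_zero ((uncovered_of_not_subset hcon).symm.trans (hω hωF))

theorem ae_coverTime_le_iff (hX : IsGrowthProcess lam μ ℱ X) (hlam : ∀ x, 0 < lam x)
    (hfin : IsLocallyFinite P) (B : FinLowerSet P) :
    ∀ᵐ ω ∂μ, ∀ t : ℝ≥0, coverTime X B.carrier ω ≤ t ↔ B.carrier ⊆ (X t ω).carrier := by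
  obtain ⟨Q, hQc, hQd⟩ := TopologicalSpace.exists_countable_dense ℝ≥0
  have hmono : ∀ᵐ ω ∂μ, ∀ s ∈ Q, ∀ t ∈ Q, s ≤ t →
      B.carrier ⊆ (X s ω).carrier → B.carrier ⊆ (X t ω).carrier :=
    (ae_ball_iff hQc).2 fun s _ => (ae_ball_iff hQc).2 fun t _ =>
      ae_all_iff.2 fun hst => hX.ae_subset_of_le hlam hfin B hst
  filter_upwards [hmono, hX.rightCts] with ω hω hrc
  have exists_mem_Ioo {s t : ℝ≥0} (hst : s < t) : ∃ q ∈ Q, s < q ∧ q < t ∧ X q ω = X s ω := by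
    obtain ⟨u, hu, hsub⟩ := (mem_nhdsGT_iff_exists_Ioo_subset' hst).1 (hrc s)
    obtain ⟨q, hqQ, hsq, hq⟩ := hQd.exists_between (lt_min hst hu)
    exact ⟨q, hqQ, hsq, hq.trans_le (min_le_left _ _), hsub ⟨hsq, hq.trans_le (min_le_right _ _)⟩⟩
  refine coverTime_le_iff hrc fun s t hst hs => ?_
  rcases hst.eq_or_lt with rfl | hlt
  · exact hs
  · obtain ⟨p, hpQ, -, hpt, hp⟩ := exists_mem_Ioo hlt
    obtain ⟨q, hqQ, htq, -, hq⟩ := exists_mem_Ioo (lt_add_one t)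
    exact hq ▸ hω p hpQ q hqQ (hpt.trans htq).le (hp ▸ hs)

theorem integrable_uncoveredTime (hX : IsGrowthProcess lam μ ℱ X) (B : FinLowerSet P) (t : ℝ≥0) :
    Integrable (uncoveredTime X B t) μ :=
  hX.integrable_timeIntegral (fun A => abs_uncovered_le A.carrier) t

theorem ae_uncoveredTime_eq (hX : IsGrowthProcess lam μ ℱ X) (hlam : ∀ x, 0 < lam x)
    (hfin : IsLocallyFinite P) (B : FinLowerSet P) :
    ∀ᵐ ω ∂μ, ∀ t : ℝ≥0,
      uncoveredTime X B t ω = (min (t : ℝ≥0∞) (coverTime X B.carrier ω)).toReal :=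
  (hX.ae_coverTime_le_iff hlam hfin B).mono fun _ hω => uncoveredTime_eq_toReal_min hω

theorem ae_tendsto_ofReal_uncoveredTime (hX : IsGrowthProcess lam μ ℱ X) (hlam : ∀ x, 0 < lam x)
    (hfin : IsLocallyFinite P) (B : FinLowerSet P) :
    ∀ᵐ ω ∂μ, Tendsto (fun n : ℕ => ENNReal.ofReal (uncoveredTime X B n ω)) atTop
      (𝓝 (coverTime X B.carrier ω)) := by
  filter_upwards [hX.ae_uncoveredTime_eq hlam hfin B] with ω hω
  refine (tendsto_natCast_min _).congr fun n => ?_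
  rw [hω, ENNReal.ofReal_toReal ((min_le_left _ _).trans_lt ENNReal.coe_lt_top).ne]

theorem integral_meanCoverTime (hX : IsGrowthProcess lam μ ℱ X) (hlam : ∀ x, 0 < lam x)
    (hfin : IsLocallyFinite P) (B : FinLowerSet P) (t : ℝ≥0) :
    ∫ ω, meanCoverTime lam B (X t ω).carrier ∂μ =
      meanCoverTime lam B ∅ - ∫ ω, uncoveredTime X B t ω ∂μ := by
  rw [hX.integral_comp_eq_of_isLocal hlam hfin isLocal_meanCoverTime, sub_eq_add_neg,
    ← integral_neg]
  simp only [localGenerator_meanCoverTime_eq_neg_uncovered hlam, timeIntegral_neg, uncoveredTime]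

theorem aemeasurable_coverTime (hX : IsGrowthProcess lam μ ℱ X) (hlam : ∀ x, 0 < lam x)
    (hfin : IsLocallyFinite P) (B : FinLowerSet P) : AEMeasurable (coverTime X B.carrier) μ :=
  aemeasurable_of_tendsto_metrizable_ae atTop
    (fun n : ℕ => (hX.integrable_uncoveredTime B n).aemeasurable.ennreal_ofReal)
    (hX.ae_tendsto_ofReal_uncoveredTime hlam hfin B)

theorem lintegral_coverTime_ne_top (hX : IsGrowthProcess lam μ ℱ X) (hlam : ∀ x, 0 < lam x)
    (hfin : IsLocallyFinite P) (B : FinLowerSet P) : ∫⁻ ω, coverTime X B.carrier ω ∂μ ≠ ∞ := by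
  refine ne_top_of_le_ne_top (ENNReal.ofReal_ne_top (r := meanCoverTime lam B ∅))
    (lintegral_le_of_tendsto
      (fun n : ℕ => (hX.integrable_uncoveredTime B n).aemeasurable.ennreal_ofReal)
      (hX.ae_tendsto_ofReal_uncoveredTime hlam hfin B) fun n => ?_)
  rw [← ofReal_integral_eq_lintegral_ofReal (hX.integrable_uncoveredTime B n)
    (.of_forall fun ω => timeIntegral_nonneg (fun A => uncovered_nonneg A.carrier) _ ω)]
  refine ENNReal.ofReal_le_ofReal (sub_nonneg.1 ?_)
  rw [← hX.integral_meanCoverTime hlam hfin]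
  exact integral_nonneg fun ω => meanCoverTime_nonneg hlam _

theorem ae_coverTime_ne_top (hX : IsGrowthProcess lam μ ℱ X) (hlam : ∀ x, 0 < lam x)
    (hfin : IsLocallyFinite P) (B : FinLowerSet P) : ∀ᵐ ω ∂μ, coverTime X B.carrier ω ≠ ∞ :=
  (ae_lt_top' (hX.aemeasurable_coverTime hlam hfin B)
    (hX.lintegral_coverTime_ne_top hlam hfin B)).mono fun _ hω => hω.ne

theorem integrable_coverTime (hX : IsGrowthProcess lam μ ℱ X) (hlam : ∀ x, 0 < lam x)
    (hfin : IsLocallyFinite P) (B : FinLowerSet P) :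
    Integrable (fun ω => (coverTime X B.carrier ω).toReal) μ :=
  integrable_toReal_of_lintegral_ne_top (hX.aemeasurable_coverTime hlam hfin B)
    (hX.lintegral_coverTime_ne_top hlam hfin B)

theorem ae_uncoveredTime_eq_min (hX : IsGrowthProcess lam μ ℱ X) (hlam : ∀ x, 0 < lam x)
    (hfin : IsLocallyFinite P) (B : FinLowerSet P) :
    ∀ᵐ ω ∂μ, ∀ t : ℝ≥0, uncoveredTime X B t ω = min (t : ℝ) (coverTime X B.carrier ω).toReal := by
  filter_upwards [hX.ae_uncoveredTime_eq hlam hfin B, hX.ae_coverTime_ne_top hlam hfin B]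
    with ω hω htop t
  rw [hω, ENNReal.toReal_min ENNReal.coe_ne_top htop, ENNReal.coe_toReal]

theorem ae_eventually_subset (hX : IsGrowthProcess lam μ ℱ X) (hlam : ∀ x, 0 < lam x)
    (hfin : IsLocallyFinite P) (B : FinLowerSet P) :
    ∀ᵐ ω ∂μ, ∀ᶠ n : ℕ in atTop, B.carrier ⊆ (X n ω).carrier := by
  filter_upwards [hX.ae_coverTime_ne_top hlam hfin B, hX.ae_coverTime_le_iff hlam hfin B]
    with ω htop hω
  filter_upwards [eventually_ge_atTop ⌈(coverTime X B.carrier ω).toNNReal⌉₊] with n hn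
  refine (hω n).1 ?_
  rw [← ENNReal.coe_toNNReal htop]
  exact_mod_cast Nat.ceil_le.1 hn

theorem tendsto_integral_meanCoverTime (hX : IsGrowthProcess lam μ ℱ X) (hlam : ∀ x, 0 < lam x)
    (hfin : IsLocallyFinite P) (B : FinLowerSet P) :
    Tendsto (fun n : ℕ => ∫ ω, meanCoverTime lam B (X n ω).carrier ∂μ) atTop (𝓝 0) := by
  obtain ⟨c, hc⟩ := (isLocal_meanCoverTime (lam := lam) (B := B)).exists_abs_le
  rw [← integral_zero Ω ℝ (μ := μ)]
  refine tendsto_integral_of_dominated_convergence (fun _ => c)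
    (fun n => (hX.measurable_comp (fun A => meanCoverTime lam B A.carrier) n).aestronglyMeasurable)
    (integrable_const _) (fun n => .of_forall fun ω => hc _) ?_
  filter_upwards [hX.ae_eventually_subset hlam hfin B] with ω hω
  exact tendsto_const_nhds.congr' (hω.mono fun n hn => (meanCoverTime_of_subset hn).symm)

theorem tendsto_integral_uncoveredTime (hX : IsGrowthProcess lam μ ℱ X) (hlam : ∀ x, 0 < lam x)
    (hfin : IsLocallyFinite P) (B : FinLowerSet P) :
    Tendsto (fun n : ℕ => ∫ ω, uncoveredTime X B n ω ∂μ) atTop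
      (𝓝 (∫ ω, (coverTime X B.carrier ω).toReal ∂μ)) := by
  refine tendsto_integral_of_dominated_convergence (fun ω => (coverTime X B.carrier ω).toReal)
    (fun n => (hX.integrable_uncoveredTime B n).aestronglyMeasurable)
    (hX.integrable_coverTime hlam hfin B) (fun n => ?_) ?_
  · filter_upwards [hX.ae_uncoveredTime_eq_min hlam hfin B] with ω hω
    rw [hω, Real.norm_of_nonneg (le_min (NNReal.coe_nonneg _) ENNReal.toReal_nonneg)]
    exact min_le_right _ _
  · filter_upwards [hX.ae_uncoveredTime_eq_min hlam hfin B] with ω hω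
    refine tendsto_const_nhds.congr' ?_
    filter_upwards [eventually_ge_atTop ⌈(coverTime X B.carrier ω).toReal⌉₊] with n hn
    rw [hω, min_eq_right (by exact_mod_cast Nat.ceil_le.1 hn)]

theorem integral_coverTime (hX : IsGrowthProcess lam μ ℱ X) (hlam : ∀ x, 0 < lam x)
    (hfin : IsLocallyFinite P) (B : FinLowerSet P) :
    ∫ ω, (coverTime X B.carrier ω).toReal ∂μ = meanCoverTime lam B ∅ := by
  have hlim := (hX.tendsto_integral_meanCoverTime hlam hfin B).add
    (hX.tendsto_integral_uncoveredTime hlam hfin B)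
  simp only [hX.integral_meanCoverTime hlam hfin, sub_add_cancel, zero_add] at hlim
  exact tendsto_nhds_unique hlim tendsto_const_nhds

end IsGrowthProcess

end CoverTime

section SecondMoment

theorem setLIntegral_Ioi_le_of_forall_Ioc {f : ℝ → ℝ≥0∞} {K : ℝ≥0∞}
    (hf : ∀ n : ℕ, ∫⁻ r in Set.Ioc 0 (n : ℝ), f r ≤ K) : ∫⁻ r in Set.Ioi 0, f r ≤ K := by
  have hunion : ⋃ n : ℕ, Set.Ioc (0 : ℝ) n = Set.Ioi 0 :=
    Set.iUnion_Ioc_eq_Ioi_self_iff.2 fun x _ => exists_nat_ge x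
  have hmono : Monotone fun n : ℕ => Set.Ioc (0 : ℝ) n := fun m n hmn =>
    Set.Ioc_subset_Ioc_right (by exact_mod_cast hmn)
  rw [← hunion, setLIntegral_iUnion_of_directed _ hmono.directed_le]
  exact iSup_le hf

theorem two_mul_setLIntegral_Ioi_ofReal_sub {y : ℝ} (hy : 0 ≤ y) :
    2 * ∫⁻ r in Set.Ioi 0, ENNReal.ofReal (y - r) = ENNReal.ofReal (y ^ 2) := by
  have hzero : ∫⁻ r in Set.Ioi y, ENNReal.ofReal (y - r) = 0 :=
    setLIntegral_eq_zero measurableSet_Ioi fun r hr =>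
      ENNReal.ofReal_of_nonpos (sub_nonpos.2 (le_of_lt hr))
  have hmain : ∫⁻ r in Set.Ioc 0 y, ENNReal.ofReal (y - r) = ENNReal.ofReal (y ^ 2 / 2) := by
    rw [← ofReal_integral_eq_lintegral_ofReal, ← intervalIntegral.integral_of_le hy,
      intervalIntegral.integral_sub (by simp) (by simp), integral_id,
      intervalIntegral.integral_const, smul_eq_mul]
    · ring_nf
    · exact (Continuous.integrableOn_Icc (by fun_prop)).mono_set Set.Ioc_subset_Icc_self
    · exact ae_restrict_of_forall_mem measurableSet_Ioc fun r hr => sub_nonneg.2 hr.2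
  rw [← Set.Ioc_union_Ioi_eq_Ioi hy, lintegral_union measurableSet_Ioi Set.Ioc_disjoint_Ioi_same,
    hzero, add_zero, hmain, ← ENNReal.ofReal_ofNat, ← ENNReal.ofReal_mul zero_le_two,
    mul_div_cancel₀ _ two_ne_zero]

variable {P : Type*} [PartialOrder P] {lam : P → ℝ} {Ω : Type*} [mΩ : MeasurableSpace Ω]
  {μ : Measure Ω} [IsProbabilityMeasure μ] {ℱ : Filtration ℝ≥0 mΩ} {X : ℝ≥0 → Ω → FinLowerSet P}

namespace IsGrowthProcess

theorem lintegral_ofReal_coverTime_sub (hX : IsGrowthProcess lam μ ℱ X) (hlam : ∀ x, 0 < lam x)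
    (hfin : IsLocallyFinite P) (B : FinLowerSet P) (t : ℝ≥0) :
    ∫⁻ ω, ENNReal.ofReal ((coverTime X B.carrier ω).toReal - t) ∂μ =
      ENNReal.ofReal (∫ ω, meanCoverTime lam B (X t ω).carrier ∂μ) := by
  have hint := hX.integrable_coverTime hlam hfin B
  have hint' := hX.integrable_uncoveredTime B t
  rw [hX.integral_meanCoverTime hlam hfin, ← hX.integral_coverTime hlam hfin,
    ← integral_sub hint hint', ofReal_integral_eq_lintegral_ofReal (by exact hint.sub hint')]
  · refine lintegral_congr_ae ?_
    filter_upwards [hX.ae_uncoveredTime_eq_min hlam hfin B] with ω hω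
    rw [hω]
    rcases le_total (t : ℝ) (coverTime X B.carrier ω).toReal with hle | hle
    · rw [min_eq_left hle]
    · rw [min_eq_right hle, sub_self, ENNReal.ofReal_zero,
        ENNReal.ofReal_of_nonpos (sub_nonpos.2 hle)]
  · filter_upwards [hX.ae_uncoveredTime_eq_min hlam hfin B] with ω hω
    exact sub_nonneg.2 ((hω t).trans_le (min_le_right _ _))

theorem integral_timeIntegral_meanCoverTime_le (hX : IsGrowthProcess lam μ ℱ X)
    (hlam : ∀ x, 0 < lam x) (hfin : IsLocallyFinite P) (B : FinLowerSet P) (t : ℝ≥0) :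
    ∫ ω, timeIntegral X (fun A => meanCoverTime lam B A.carrier) t ω ∂μ ≤
      sqCoverTime lam B ∅ / 2 := by
  have hdynkin := hX.integral_comp_eq_of_isLocal hlam hfin
    (isLocal_sqCoverTime (lam := lam) (B := B)) t
  simp only [localGenerator_sqCoverTime hlam, timeIntegral_neg, timeIntegral_const_mul,
    integral_neg, integral_const_mul] at hdynkin
  have hnonneg : 0 ≤ ∫ ω, sqCoverTime lam B (X t ω).carrier ∂μ :=
    integral_nonneg fun ω => sqCoverTime_nonneg hlam _
  linarith

theorem setLIntegral_integral_meanCoverTime (hX : IsGrowthProcess lam μ ℱ X)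
    (hlam : ∀ x, 0 < lam x) (B : FinLowerSet P) (t : ℝ≥0) :
    ∫⁻ r in Set.Ioc 0 (t : ℝ),
        ENNReal.ofReal (∫ ω, meanCoverTime lam B (X r.toNNReal ω).carrier ∂μ) =
      ENNReal.ofReal
        (∫ ω, timeIntegral X (fun A => meanCoverTime lam B A.carrier) t ω ∂μ) := by
  obtain ⟨c, hc⟩ := (isLocal_meanCoverTime (lam := lam) (B := B)).exists_abs_le
  have hint := hX.integrable_prod (fun A => hc A.carrier) (volume.restrict (Set.Ioc 0 (t : ℝ)))
  simp only [timeIntegral, intervalIntegral.integral_of_le t.coe_nonneg]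
  rw [← integral_integral_swap hint, ofReal_integral_eq_lintegral_ofReal hint.integral_prod_left]
  exact .of_forall fun r => integral_nonneg fun ω => meanCoverTime_nonneg hlam _

/-- The square of the cover time is twice the integral of its excess over `r`, whose mean is that of
the mean cover time from the state at time `r`. -/
theorem lintegral_sq_coverTime_le (hX : IsGrowthProcess lam μ ℱ X) (hlam : ∀ x, 0 < lam x)
    (hfin : IsLocallyFinite P) (B : FinLowerSet P) :
    ∫⁻ ω, ENNReal.ofReal ((coverTime X B.carrier ω).toReal ^ 2) ∂μ ≤
      2 * ENNReal.ofReal (sqCoverTime lam B ∅ / 2) := by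
  have hmeas : AEMeasurable (fun p : Ω × ℝ =>
      ENNReal.ofReal ((coverTime X B.carrier p.1).toReal - p.2))
      (μ.prod (volume.restrict (Set.Ioi 0))) :=
    ((hX.aemeasurable_coverTime hlam hfin B).ennreal_toReal.comp_fst.sub
      measurable_snd.aemeasurable).ennreal_ofReal
  simp only [← two_mul_setLIntegral_Ioi_ofReal_sub ENNReal.toReal_nonneg]
  rw [lintegral_const_mul' _ _ ENNReal.ofNat_ne_top, lintegral_lintegral_swap hmeas]
  refine mul_le_mul_right (setLIntegral_Ioi_le_of_forall_Ioc fun n => ?_) 2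
  calc ∫⁻ r in Set.Ioc 0 (n : ℝ),
        ∫⁻ ω, ENNReal.ofReal ((coverTime X B.carrier ω).toReal - r) ∂μ
      = ∫⁻ r in Set.Ioc 0 (n : ℝ),
          ENNReal.ofReal (∫ ω, meanCoverTime lam B (X r.toNNReal ω).carrier ∂μ) := by
        refine setLIntegral_congr_fun measurableSet_Ioc fun r hr => ?_
        rw [← hX.lintegral_ofReal_coverTime_sub hlam hfin, Real.coe_toNNReal r hr.1.le]
    _ = ENNReal.ofReal
          (∫ ω, timeIntegral X (fun A => meanCoverTime lam B A.carrier) n ω ∂μ) :=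
        hX.setLIntegral_integral_meanCoverTime hlam B n
    _ ≤ ENNReal.ofReal (sqCoverTime lam B ∅ / 2) :=
        ENNReal.ofReal_le_ofReal (hX.integral_timeIntegral_meanCoverTime_le hlam hfin B n)

theorem memLp_coverTime (hX : IsGrowthProcess lam μ ℱ X) (hlam : ∀ x, 0 < lam x)
    (hfin : IsLocallyFinite P) (B : FinLowerSet P) :
    MemLp (fun ω => (coverTime X B.carrier ω).toReal) 2 μ := by
  have hmeas := (hX.integrable_coverTime hlam hfin B).aestronglyMeasurable
  rw [memLp_two_iff_integrable_sq hmeas]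
  exact (lintegral_ofReal_ne_top_iff_integrable (hmeas.pow 2) (.of_forall fun _ => sq_nonneg _)).1
    (ne_top_of_le_ne_top (ENNReal.mul_ne_top ENNReal.ofNat_ne_top ENNReal.ofReal_ne_top)
      (hX.lintegral_sq_coverTime_le hlam hfin B))

theorem integral_sq_coverTime_le (hX : IsGrowthProcess lam μ ℱ X) (hlam : ∀ x, 0 < lam x)
    (hfin : IsLocallyFinite P) (B : FinLowerSet P) :
    ∫ ω, (coverTime X B.carrier ω).toReal ^ 2 ∂μ ≤ sqCoverTime lam B ∅ := by
  rw [← ENNReal.ofReal_le_ofReal_iff (sqCoverTime_nonneg hlam ∅),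
    ofReal_integral_eq_lintegral_ofReal (hX.memLp_coverTime hlam hfin B).integrable_sq
      (.of_forall fun _ => sq_nonneg _), ← mul_div_cancel₀ (sqCoverTime lam B ∅) two_ne_zero,
    ENNReal.ofReal_mul zero_le_two, ENNReal.ofReal_ofNat]
  exact hX.lintegral_sq_coverTime_le hlam hfin B

end IsGrowthProcess

end SecondMoment

/-! ### Limits -/

section Asymptotics

theorem exists_tendsto_div_of_superadditive {u : ℕ → ℝ} {c K : ℝ} (hK : 0 ≤ K)
    (hu : ∀ m n, u m + u n ≤ u (m + n) + c) (hle : ∀ n : ℕ, u n ≤ K * (n + 1)) :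
    ∃ l, Tendsto (fun n : ℕ => u n / n) atTop (𝓝 l) := by
  have hsub : Subadditive fun n => c - u n := fun m n => by linarith [hu m n]
  have hbdd : BddBelow (Set.range fun n : ℕ => (c - u n) / n) := by
    refine ⟨-(|c| + 2 * K), ?_⟩
    rintro _ ⟨n, rfl⟩
    rcases n.eq_zero_or_pos with rfl | hn
    · simp only [Nat.cast_zero, div_zero]
      linarith [abs_nonneg c]
    · have hn' : (1 : ℝ) ≤ n := by exact_mod_cast hn
      rw [le_div_iff₀ (by linarith)]
      nlinarith [hle n, neg_abs_le c, abs_nonneg c]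
  refine ⟨0 - hsub.lim, ?_⟩
  refine ((tendsto_const_div_atTop_nhds_zero_nat c).sub (hsub.tendsto_lim hbdd)).congr fun n => ?_
  rw [← sub_div, sub_sub_cancel]

theorem le_sq_add_of_forall_le {g a x y : ℝ} (hx : 0 < x) (hy : 0 < y)
    (h : ∀ u, 0 < u → u < 1 → g ≤ a * (x ^ 2 / u + y ^ 2 / (1 - u))) : g ≤ a * (x + y) ^ 2 := by
  have hu := h (x / (x + y)) (by positivity) ((div_lt_one (by positivity)).2 (by linarith))
  have hsub : 1 - x / (x + y) = y / (x + y) := by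
    field_simp
    ring
  refine hu.trans_eq ?_
  rw [hsub]
  field_simp

theorem le_sq_sqrt_add_sqrt_of_forall_le {g a k l : ℝ} (ha : 0 ≤ a) (hk : 0 ≤ k) (hl : 0 ≤ l)
    (h : ∀ u, 0 < u → u < 1 → g ≤ a * (k / u + l / (1 - u))) : g ≤ a * (√k + √l) ^ 2 := by
  -- The optimal `u = √k / (√k + √l)` may be `0` or `1`, hence the perturbation by `ε`.
  have hperturb : ∀ ε > 0, g ≤ a * ((√k + ε) + (√l + ε)) ^ 2 := fun ε hε => by
    have hkε : k ≤ (√k + ε) ^ 2 := by nlinarith [Real.sq_sqrt hk, Real.sqrt_nonneg k]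
    have hlε : l ≤ (√l + ε) ^ 2 := by nlinarith [Real.sq_sqrt hl, Real.sqrt_nonneg l]
    refine le_sq_add_of_forall_le (by positivity) (by positivity) fun u hu0 hu1 => ?_
    have : 0 ≤ 1 - u := by linarith
    exact (h u hu0 hu1).trans (by gcongr)
  have hlim : Tendsto (fun ε : ℝ => a * ((√k + ε) + (√l + ε)) ^ 2) (𝓝[>] 0)
      (𝓝 (a * ((√k + 0) + (√l + 0)) ^ 2)) :=
    (Continuous.tendsto (by fun_prop) 0).mono_left nhdsWithin_le_nhds
  simp only [add_zero] at hlim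
  exact ge_of_tendsto hlim (eventually_mem_nhdsWithin.mono hperturb)

theorem iInf_le_of_iInf_pos {ι : Type*} {f : ι → ℝ} (hf : 0 < ⨅ i, f i) (i : ι) :
    ⨅ i, f i ≤ f i :=
  ciInf_le (by_contra fun h => hf.ne' (Real.iInf_of_not_bddBelow h)) i

end Asymptotics

section LawOfLargeNumbers

variable {Ω : Type*} [MeasurableSpace Ω] {μ : Measure Ω}

theorem tendsto_eLpNorm_two_of_tendsto_integral_sq {f : ℕ → Ω → ℝ} (hf : ∀ n, MemLp (f n) 2 μ)
    (hlim : Tendsto (fun n => ∫ ω, f n ω ^ 2 ∂μ) atTop (𝓝 0)) :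
    Tendsto (fun n => eLpNorm (f n) 2 μ) atTop (𝓝 0) := by
  have heq : ∀ n, eLpNorm (f n) 2 μ = ENNReal.ofReal (√(∫ ω, f n ω ^ 2 ∂μ)) := fun n => by
    rw [(hf n).eLpNorm_eq_integral_rpow_norm two_ne_zero ENNReal.ofNat_ne_top, Real.sqrt_eq_rpow]
    simp
  simpa [heq] using ENNReal.tendsto_ofReal hlim.sqrt

variable [IsProbabilityMeasure μ]

theorem integral_sq_div_sub {f : Ω → ℝ} (hf : MemLp f 2 μ) (x g : ℝ) :
    ∫ ω, (f ω / x - g) ^ 2 ∂μ =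
      (∫ ω, f ω ^ 2 ∂μ) / x ^ 2 - 2 * g * ((∫ ω, f ω ∂μ) / x) + g ^ 2 := by
  have hsq : Integrable (fun ω => f ω ^ 2 / x ^ 2) μ := hf.integrable_sq.div_const _
  have hlin : Integrable (fun ω => 2 * g * (f ω / x)) μ :=
    ((hf.integrable one_le_two).div_const _).const_mul _
  have hsub : Integrable (fun ω => f ω ^ 2 / x ^ 2 - 2 * g * (f ω / x)) μ := hsq.sub hlin
  calc ∫ ω, (f ω / x - g) ^ 2 ∂μ
      = ∫ ω, (f ω ^ 2 / x ^ 2 - 2 * g * (f ω / x) + g ^ 2) ∂μ := by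
        congr 1 with ω
        ring
    _ = _ := by
        rw [integral_add hsub (integrable_const _), integral_sub hsq hlin, integral_div,
          integral_const_mul, integral_div, integral_const, probReal_univ, one_smul]

theorem tendsto_eLpNorm_div_sub {f : ℕ → Ω → ℝ} {g c : ℝ} (hf : ∀ n, MemLp (f n) 2 μ)
    (hg : Tendsto (fun n : ℕ => (∫ ω, f n ω ∂μ) / n) atTop (𝓝 g))
    (hvar : ∀ n, ∫ ω, f n ω ^ 2 ∂μ ≤ (∫ ω, f n ω ∂μ) ^ 2 + (∫ ω, f n ω ∂μ) / c) :
    Tendsto (fun n : ℕ => eLpNorm (fun ω => f n ω / n - g) 2 μ) atTop (𝓝 0) := by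
  have hmem : ∀ n : ℕ, MemLp (fun ω => f n ω / n - g) 2 μ := fun n => by
    simp only [div_eq_inv_mul]
    exact ((hf n).const_mul _).sub (memLp_const g)
  refine tendsto_eLpNorm_two_of_tendsto_integral_sq hmem ?_
  have hbound : Tendsto (fun n : ℕ => ((∫ ω, f n ω ∂μ) / n - g) ^ 2 +
      (∫ ω, f n ω ∂μ) / n * (c⁻¹ / n)) atTop (𝓝 0) := by
    simpa using ((hg.sub_const g).pow 2).add (hg.mul (tendsto_const_div_atTop_nhds_zero_nat c⁻¹))
  refine squeeze_zero (fun n => integral_nonneg fun _ => sq_nonneg _) (fun n => ?_) hbound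
  calc ∫ ω, (f n ω / n - g) ^ 2 ∂μ
      = (∫ ω, f n ω ^ 2 ∂μ) / n ^ 2 - 2 * g * ((∫ ω, f n ω ∂μ) / n) + g ^ 2 :=
        integral_sq_div_sub (hf n) n g
    _ ≤ ((∫ ω, f n ω ∂μ) ^ 2 + (∫ ω, f n ω ∂μ) / c) / n ^ 2
          - 2 * g * ((∫ ω, f n ω ∂μ) / n) + g ^ 2 := by
        gcongr
        exact hvar n
    _ = ((∫ ω, f n ω ∂μ) / n - g) ^ 2 + (∫ ω, f n ω ∂μ) / n * (c⁻¹ / n) := by ring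

end LawOfLargeNumbers

theorem meanCoverTime_limit_le {P : Type*} [PartialOrder P] {lam : P → ℝ} {c : ℝ} (hc : 0 < c)
    (hlam : ∀ x, c ≤ lam x) {B : ℕ → FinLowerSet P} {g k l : ℝ}
    (hg : Tendsto (fun n : ℕ => meanCoverTime lam (B n) ∅ / n) atTop (𝓝 g))
    (hk : Tendsto (fun n : ℕ => width (B n).carrier / n) atTop (𝓝 k))
    (hl : Tendsto (fun n : ℕ => (len (B n).carrier : ℝ) / n) atTop (𝓝 l)) :
    g ≤ 1 / c * (√k + √l) ^ 2 := by
  have hk0 : 0 ≤ k := ge_of_tendsto' hk fun n =>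
    div_nonneg (Real.log_natCast_nonneg _) n.cast_nonneg
  have hl0 : 0 ≤ l := ge_of_tendsto' hl fun n => by positivity
  refine le_sq_sqrt_add_sqrt_of_forall_le (by positivity) hk0 hl0 fun u hu0 hu1 => ?_
  refine le_of_tendsto_of_tendsto' hg
    (((hk.div_const u).add (hl.div_const (1 - u))).const_mul (1 / c)) fun n => ?_
  calc meanCoverTime lam (B n) ∅ / n
      ≤ 1 / c * (width (B n).carrier / u + len (B n).carrier / (1 - u)) / n := by
        gcongr
        exact meanCoverTime_empty_le hc hlam hu0 hu1
    _ = 1 / c * (width (B n).carrier / n / u + len (B n).carrier / n / (1 - u)) := by ring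

section Powers

variable {M : Type*} [Monoid M] [PartialOrder M]

/-- The power `A ^ n` in the monoid `L(M)` of finite lower sets, bundled so that it can serve as
the target of the growth process. -/
def FinLowerSet.pow (hfin : ∀ a : M, (Set.Iic a).Finite) (A : FinLowerSet M) (n : ℕ) :
    FinLowerSet M where
  carrier := lowerPow A.carrier n
  finite := finite_lowerPow hfin A.finite n
  lower := isLowerSet_lowerPow A.carrier n

variable [CanonicallyOrderedMul M] [MulLeftReflectLE M] {A : Set M} {lam : M → ℝ}

theorem exists_tendsto_len_lowerPow_div (hfin : ∀ a : M, (Set.Iic a).Finite)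
    (hsteady : IsSteady M) (hA : A.Finite) (hlow : IsLowerSet A) (hne : A.Nonempty) :
    ∃ l, Tendsto (fun n : ℕ => (len (lowerPow A n) : ℝ) / n) atTop (𝓝 l) := by
  obtain ⟨K, hK, hle⟩ := exists_len_lowerPow_le hfin hsteady hA hlow
  refine exists_tendsto_div_of_superadditive hK (c := 1) (fun m n => ?_) hle
  have hone := one_mem_lowerPow (one_mem_of_isLowerSet hlow hne)
  have hpow := finite_lowerPow hfin hA
  rw [lowerPow_add]
  exact_mod_cast len_add_len_le (hpow m) (hpow n) (finite_lowerMul hfin (hpow m) (hpow n))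
    (hone m) (hone n)

theorem exists_width_lowerPow_le (hfin : IsLocallyFinite M) (hsteady : IsSteady M)
    (hA : A.Finite) (hlow : IsLowerSet A) :
    ∃ K : ℝ, 0 ≤ K ∧ ∀ n : ℕ, width (lowerPow A n) ≤ K * (n + 1) := by
  obtain ⟨K, hK, hle⟩ := exists_len_lowerPow_le hfin.1 hsteady hA hlow
  have hlog : 0 ≤ Real.log ({s : M | 1 ⋖ s}.ncard + 2) := Real.log_nonneg (by norm_cast; omega)
  refine ⟨K * Real.log ({s : M | 1 ⋖ s}.ncard + 2), mul_nonneg hK hlog, fun n => ?_⟩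
  rw [mul_right_comm]
  exact (width_le_len_mul_log (hfin.2.2 1) (finite_lowerPow hfin.1 hA n)).trans
    (mul_le_mul_of_nonneg_right (hle n) hlog)

theorem exists_tendsto_width_lowerPow_div (hfin : IsLocallyFinite M) (hsteady : IsSteady M)
    (hA : A.Finite) (hlow : IsLowerSet A) (hne : A.Nonempty) :
    ∃ k, Tendsto (fun n : ℕ => width (lowerPow A n) / n) atTop (𝓝 k) := by
  obtain ⟨K, hK, hle⟩ := exists_width_lowerPow_le hfin hsteady hA hlow
  refine exists_tendsto_div_of_superadditive hK (c := 0) (fun m n => ?_) hle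
  have hone := one_mem_lowerPow (one_mem_of_isLowerSet hlow hne)
  have hpow := finite_lowerPow hfin.1 hA
  rw [lowerPow_add, add_zero]
  exact width_add_width_le (hpow m) (hpow n) (finite_lowerMul hfin.1 (hpow m) (hpow n))
    (hone m) (hone n)

theorem exists_meanCoverTime_pow_le {c : ℝ} (hc : 0 < c) (hlam : ∀ x, c ≤ lam x)
    (hfin : IsLocallyFinite M) (hsteady : IsSteady M) (A : FinLowerSet M) :
    ∃ K : ℝ, 0 ≤ K ∧ ∀ n : ℕ, meanCoverTime lam (A.pow hfin.1 n) ∅ ≤ K * (n + 1) := by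
  obtain ⟨Kw, hKw, hwidth⟩ := exists_width_lowerPow_le hfin hsteady A.finite A.lower
  obtain ⟨Kl, hKl, hlen⟩ := exists_len_lowerPow_le hfin.1 hsteady A.finite A.lower
  refine ⟨1 / c * (2 * (Kw + Kl)), by positivity, fun n => ?_⟩
  calc meanCoverTime lam (A.pow hfin.1 n) ∅
      ≤ 1 / c * (width (lowerPow A.carrier n) / (1 / 2)
          + len (lowerPow A.carrier n) / (1 - 1 / 2)) :=
        meanCoverTime_empty_le hc hlam (by norm_num) (by norm_num)
    _ ≤ 1 / c * (Kw * (n + 1) / (1 / 2) + Kl * (n + 1) / (1 - 1 / 2)) := by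
        have : (0 : ℝ) ≤ 1 - 1 / 2 := by norm_num
        gcongr
        exacts [hwidth n, hlen n]
    _ = 1 / c * (2 * (Kw + Kl)) * (n + 1) := by ring

theorem exists_tendsto_meanCoverTime_pow_div {c : ℝ} (hc : 0 < c) (hlam : ∀ x, c ≤ lam x)
    (hanti : Antitone lam) (hfin : IsLocallyFinite M) (hsteady : IsSteady M) {A : FinLowerSet M}
    (hne : A.carrier.Nonempty) :
    ∃ g, Tendsto (fun n : ℕ => meanCoverTime lam (A.pow hfin.1 n) ∅ / n) atTop (𝓝 g) := by
  obtain ⟨K, hK, hle⟩ := exists_meanCoverTime_pow_le hc hlam hfin hsteady A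
  have hone := one_mem_lowerPow (one_mem_of_isLowerSet A.lower hne)
  exact exists_tendsto_div_of_superadditive hK (fun m n =>
    meanCoverTime_add_le (fun x => hc.trans_le (hlam x)) hanti (lowerPow_add A.carrier m n)
      (hone m) (hone n)) hle

end Powers

section Cone

variable {G : Type*} [Group G] [PartialOrder G] [MulLeftMono G]

instance [MulRightMono G] : CanonicallyOrderedMul (Cone G) where
  exists_mul_of_le {a b} hab := ⟨⟨a.1⁻¹ * b.1, le_inv_mul_iff_mul_le.2 (by simpa using hab)⟩,
    Subtype.ext (mul_inv_cancel_left a.1 b.1).symm⟩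
  le_mul_self a b := le_mul_of_one_le_left' (α := G) b.2
  le_self_mul a b := le_mul_of_one_le_right' (α := G) b.2

instance : MulLeftReflectLE (Cone G) where
  le_of_mul_le_mul_left' h := le_of_mul_le_mul_left' (α := G) h

end Cone

end CrystalGrowth

end

open CrystalGrowth in
theorem theorem3p13_general {M : Type*} [Monoid M] [PartialOrder M] [CanonicallyOrderedMul M]
    [MulLeftReflectLE M] (hfin : IsLocallyFinite M)
    (hsteady : IsSteady M)
    (lam : M → ℝ) (hlam : 0 < ⨅ x, lam x) (hanti : Antitone lam)
    {Ω : Type*} [mΩ : MeasurableSpace Ω] (μ : Measure Ω) [IsProbabilityMeasure μ]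
    (ℱ : Filtration ℝ≥0 mΩ) (X : ℝ≥0 → Ω → FinLowerSet M)
    (hX : IsGrowthProcess lam μ ℱ X)
    (A : Set M) (hA : A.Finite) (hA' : IsLowerSet A) (hne : A.Nonempty) :
    (∀ n : ℕ, ∀ᵐ ω ∂μ, coverTime X (lowerPow A n) ω ≠ ∞) ∧
    (∀ n : ℕ,
      MemLp (fun ω => (coverTime X (lowerPow A n) ω).toReal) 2 μ) ∧
    ∃ g k l : ℝ,
      Tendsto (fun n : ℕ =>
        (∫ ω, (coverTime X (lowerPow A n) ω).toReal ∂μ) / (n : ℝ))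
        atTop (𝓝 g) ∧
      Tendsto (fun n : ℕ => width (lowerPow A n) / (n : ℝ))
        atTop (𝓝 k) ∧
      Tendsto (fun n : ℕ => (len (lowerPow A n) : ℝ) / (n : ℝ))
        atTop (𝓝 l) ∧
      g ≤ 1 / (⨅ x, lam x) * (√k + √l) ^ 2 ∧
      Tendsto (fun n : ℕ => eLpNorm (fun ω =>
        (coverTime X (lowerPow A n) ω).toReal / (n : ℝ) - g) 2 μ)
        atTop (𝓝 0) := by
  have hle := iInf_le_of_iInf_pos hlam
  have hpos : ∀ x, 0 < lam x := fun x => hlam.trans_le (hle x)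
  let A₀ : FinLowerSet M := ⟨A, hA, hA'⟩
  let B (n : ℕ) : FinLowerSet M := A₀.pow hfin.1 n
  have hmean (n : ℕ) : ∫ ω, (coverTime X (lowerPow A n) ω).toReal ∂μ = meanCoverTime lam (B n) ∅ :=
    hX.integral_coverTime hpos hfin (B n)
  have hmem (n : ℕ) : MemLp (fun ω => (coverTime X (lowerPow A n) ω).toReal) 2 μ :=
    hX.memLp_coverTime hpos hfin (B n)
  obtain ⟨g, hg⟩ := exists_tendsto_meanCoverTime_pow_div hlam hle hanti hfin hsteady (A := A₀) hne
  obtain ⟨k, hk⟩ := exists_tendsto_width_lowerPow_div hfin hsteady hA hA' hne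
  obtain ⟨l, hl⟩ := exists_tendsto_len_lowerPow_div hfin.1 hsteady hA hA' hne
  have hg' : Tendsto (fun n : ℕ => (∫ ω, (coverTime X (lowerPow A n) ω).toReal ∂μ) / n)
      atTop (𝓝 g) := by
    simpa only [hmean] using hg
  refine ⟨fun n => hX.ae_coverTime_ne_top hpos hfin (B n), hmem, g, k, l, hg', hk, hl,
    meanCoverTime_limit_le hlam hle hg hk hl,
    tendsto_eLpNorm_div_sub (c := ⨅ x, lam x) hmem hg' fun n => ?_⟩
  rw [hmean]
  exact (hX.integral_sq_coverTime_le hpos hfin (B n)).trans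
    (sqCoverTime_le hlam hle isLowerSet_empty)

theorem theorem3p13 {G : Type*} [Group G] [PartialOrder G] [MulLeftMono G] [MulRightMono G]
    (hfin : CrystalGrowth.IsLocallyFinite (CrystalGrowth.Cone G))
    (hsteady : CrystalGrowth.IsSteady (CrystalGrowth.Cone G))
    (lam : CrystalGrowth.Cone G → ℝ) (hlam : 0 < ⨅ x, lam x) (hanti : Antitone lam)
    {Ω : Type*} [mΩ : MeasurableSpace Ω] (μ : Measure Ω) [IsProbabilityMeasure μ]
    (ℱ : Filtration ℝ≥0 mΩ) (X : ℝ≥0 → Ω → CrystalGrowth.FinLowerSet (CrystalGrowth.Cone G))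
    (hX : CrystalGrowth.IsGrowthProcess lam μ ℱ X)
    (A : Set (CrystalGrowth.Cone G)) (hA : A.Finite) (hA' : IsLowerSet A) (hne : A.Nonempty) :
    (∀ n : ℕ, ∀ᵐ ω ∂μ, CrystalGrowth.coverTime X (CrystalGrowth.lowerPow A n) ω ≠ ∞) ∧
    (∀ n : ℕ,
      MemLp (fun ω => (CrystalGrowth.coverTime X (CrystalGrowth.lowerPow A n) ω).toReal) 2 μ) ∧
    ∃ g k l : ℝ,
      Tendsto (fun n : ℕ =>
        (∫ ω, (CrystalGrowth.coverTime X (CrystalGrowth.lowerPow A n) ω).toReal ∂μ) / (n : ℝ))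
        atTop (𝓝 g) ∧
      Tendsto (fun n : ℕ => CrystalGrowth.width (CrystalGrowth.lowerPow A n) / (n : ℝ))
        atTop (𝓝 k) ∧
      Tendsto (fun n : ℕ => (CrystalGrowth.len (CrystalGrowth.lowerPow A n) : ℝ) / (n : ℝ))
        atTop (𝓝 l) ∧
      g ≤ 1 / (⨅ x, lam x) * (√k + √l) ^ 2 ∧
      Tendsto (fun n : ℕ => eLpNorm (fun ω =>
        (CrystalGrowth.coverTime X (CrystalGrowth.lowerPow A n) ω).toReal / (n : ℝ) - g) 2 μ)
        atTop (𝓝 0) :=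
  theorem3p13_general hfin hsteady lam hlam hanti μ ℱ X hX A hA hA' hne
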